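/- Let $p$ be a prime and let $\mathbb{F}_p=\{0,1,\dots,p-1\}$ be the field with $p$ elements. Let $(\gamma_j)_{j\ge1}$ be a non-increasing sequence of real numbers with $0<\gamma_j\le1$, put $\gamma_{\mathfrak u}=\prod_{j\in\mathfrak u}\gamma_j$, and let $0=w_1\le w_2\le\cdots$ be integers. *Discrepancy.* For a multiset $\mathcal P=\{\boldsymbol x_0,\dots,\boldsymbol x_{N-1}\}\subseteq[0,1)^s$ and $\boldsymbol t\in(0,1]^s$ let $\Delta(\boldsymbol t,\mathcal P)=\frac1N\#\{n:\boldsymbol x_n\in\prod_{j=1}^s[0,t_j)\}-\prod_{j=1}^st_j$. The weighted star discrepancy is $$D^*_{N,\gamma}(\mathcal P)=\sup_{\boldsymbol t\in(0,1]^s}\max_{\emptyset\ne\mathfrak u\subseteq\{1,\dots,s\}}\gamma_{\mathfrak u}\,|\Delta((\boldsymbol t_{\mathfrak u},\boldsymbol 1),\mathcal P)|,$$ where $(\boldsymbol t_{\mathfrak u},\boldsymbol1)$ has $j$-th entry $t_j$ for $j\in\mathfrak u$ and $1$ otherwise. Let $N^*(s,\varepsilon)$ be the least $N\ge1$ with $\inf_{\mathcal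 P}D^*_{N,\gamma}(\mathcal P)\le\varepsilon$, the infimum being over all $N$-point multisets $\mathcal P\subseteq[0,1)^s$. The weighted star discrepancy is strongly polynomially tractable if there are $C,\tau>0$ with $N^*(s,\varepsilon)\le C\varepsilon^{-\tau}$ for all $s\ge1$ and $\varepsilon\in(0,1)$. *Point sets.* For $m\ge1$, $N=p^m$ and $\boldsymbol q=(q_1,\dots,q_s)\in\mathbb F_p[x]^s$, the polynomial lattice point set $\mathcal P(\boldsymbol q,x^m)$ consists of the points $\boldsymbol x_n=(\phi_m(n(x)q_i(x)/x^m))_{i=1}^s$, $0\le n<p^m$, where $n(x)=\sum_{r<m}n_rx^r$ for $n=\sum_{r<m}n_rp^r$ with digits $n_r\in\{0,\dots,p-1\}$, and $\phi_m(\sum_l t_lx^{-l})=\sum_{l=1}^m t_lp^{-l}$ for formal Laurent series in $x^{-1}$ over $\mathbb F_p$. *Reduced CBC construction.* Let $G_{p,m}$ be the set of polynomials over $\mathbb F_p$ of degree less than $m$. For $h\in G_{p,m}$ and $\gamma>0$ put $r_p(0,\gamma)=1+\gamma$, and $r_p(h,\gamma)=\gamma\,p^{-a-1}\sin^{-2}(\pi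 h_a/p)$ if $h$ has degree $a\ge0$ and leading coefficient $h_a$. For $\boldsymbol q\in\mathbb F_p[x]^d$ let $$R^d_\gamma(\boldsymbol q)=\sum_{\substack{\boldsymbol h\in G_{p,m}^d\setminus\{\boldsymbol0\}\\ x^m\mid h_1q_1+\dots+h_dq_d}}\ \prod_{i=1}^dr_p(h_i,\gamma_i).$$ Let $\mathcal G_{p,m-w}=\{g\in G_{p,m-w}:\gcd(g,x^m)=1\}$ if $w<m$ and $\mathcal G_{p,m-w}=\{1\}$ if $w\ge m$. The reduced CBC construction sets $g_1=1$ and then, for $d=1,\dots,s-1$, chooses $g_{d+1}\in\mathcal G_{p,m-w_{d+1}}$ so that $R^{d+1}_\gamma(x^{w_1}g_1,\dots,x^{w_d}g_d,x^{w_{d+1}}g)$ is minimal at $g=g_{d+1}$ among all $g\in\mathcal G_{p,m-w_{d+1}}$. It always has an output $(g_1,\dots,g_s)$. **Claim.** Suppose $\sum_{j=1}^\infty\gamma_jp^{w_j}<\infty$. Then: 1. The weighted star discrepancy is strongly polynomially tractable, and this is achieved by the reduced CBC construction: there are $C,\tau>0$ such that for all $s\ge1$ and $\varepsilon\in(0,1)$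 there is $m\ge1$ with $p^m\le C\varepsilon^{-\tau}$ such that every output $(g_1,\dots,g_s)$ of the construction satisfies $D^*_{p^m,\gamma}(\mathcal P((x^{w_1}g_1,\dots,x^{w_s}g_s),x^m))\le\varepsilon$. 2. For every $\delta>0$ there is $C_\delta>0$, independent of $s$ and $m$, such that for all $s,m\ge1$, with $N=p^m$, every output $(g_1,\dots,g_s)$ of the construction satisfies $D^*_{N,\gamma}(\mathcal P((x^{w_1}g_1,\dots,x^{w_s}g_s),x^m))\le C_\delta N^{-1+\delta}$. -/

import Mathlib

open scoped Polynomial ENNReal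

namespace PolyLattice

noncomputable section

/-! Sequences `(γ_j)_{j ≥ 1}` and `(w_j)_{j ≥ 1}` are indexed from `0`: the Lean value `γ j` is
`γ_{j+1}`, and the coordinates `1, …, s` are the elements `0, …, s - 1` of `Fin s`. -/

section Discrepancy

/-- The local discrepancy `Δ(t, P)` of the points `P 0, …, P (N - 1)` (repetitions allowed). -/
def localDisc {N s : ℕ} (P : Fin N → Fin s → ℝ) (t : Fin s → ℝ) : ℝ :=
  (1 / (N : ℝ)) * ∑ n, (Set.univ.pi fun j => Set.Ico (0 : ℝ) (t j)).indicator 1 (P n) - ∏ j, t j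

/-- The weighted star discrepancy for the product weights `γ_u = ∏_{j ∈ u} γ_j`. -/
def weightedStarDisc (γ : ℕ → ℝ) {N s : ℕ} (P : Fin N → Fin s → ℝ) : ℝ :=
  ⨆ t : {t : Fin s → ℝ // ∀ j, t j ∈ Set.Ioc (0 : ℝ) 1},
    ⨆ u : {u : Finset (Fin s) // u.Nonempty},
      (∏ j ∈ u.1, γ j) * |localDisc P fun j => if j ∈ u.1 then t.1 j else 1|

/-- The `N`th minimal weighted star discrepancy in dimension `s`. -/
def minDisc (γ : ℕ → ℝ) (N s : ℕ) : ℝ :=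
  ⨅ P : Fin N → Fin s → Set.Ico (0 : ℝ) 1, weightedStarDisc γ fun n j => (P n j : ℝ)

/-- The information complexity `N*(s, ε)`, with value `⊤` if no number of points suffices. -/
def infoComplexity (γ : ℕ → ℝ) (s : ℕ) (ε : ℝ) : ℕ∞ :=
  ⨅ N : {N : ℕ // 1 ≤ N ∧ minDisc γ N s ≤ ε}, (N.1 : ℕ∞)

/-- Strong polynomial tractability of the weighted star discrepancy. -/
def StronglyPolynomiallyTractable (γ : ℕ → ℝ) : Prop :=
  ∃ C > (0 : ℝ), ∃ τ > (0 : ℝ), ∀ s : ℕ, 1 ≤ s → ∀ ε ∈ Set.Ioo (0 : ℝ) 1,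
    (infoComplexity γ s ε : ℝ≥0∞) ≤ ENNReal.ofReal (C * ε ^ (-τ))

end Discrepancy

section PointSets

variable (p : ℕ)

/-- The embedding of `F_p[x]` into `F_p((x⁻¹))`. The latter is realised as Mathlib's Laurent series
in the variable `x⁻¹`, so that `x` is `single (-1) 1` and `L.coeff l` is the coefficient of
`x^{-l}`. -/
def toLaurent (q : (ZMod p)[X]) : LaurentSeries (ZMod p) :=
  q.eval₂ HahnSeries.C (HahnSeries.single (-1 : ℤ) (1 : ZMod p))

/-- The map `φ_m : F_p((x⁻¹)) → [0, 1)`. -/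
def phi (m : ℕ) (L : LaurentSeries (ZMod p)) : ℝ :=
  ∑ l ∈ Finset.Icc 1 m, ((L.coeff (l : ℤ)).val : ℝ) * ((p : ℝ) ^ l)⁻¹

/-- The polynomial `n(x) = ∑_{r < m} n_r x^r` given by the base-`p` digits `n_r` of `n`. -/
def digitPoly (m n : ℕ) : (ZMod p)[X] :=
  ∑ r ∈ Finset.range m, Polynomial.C ((n / p ^ r % p : ℕ) : ZMod p) * Polynomial.X ^ r

/-- The polynomial lattice point set `P(g, f)` for a modulus `f` of degree `m`. -/
def polyLatticePoints [Fact p.Prime] (m : ℕ) (f : (ZMod p)[X]) {s : ℕ} (g : Fin s → (ZMod p)[X]) :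
    Fin (p ^ m) → Fin s → ℝ :=
  fun n j => phi p m (toLaurent p (digitPoly p m n * g j) / toLaurent p f)

end PointSets

section Construction

/-- `G_{p,m}`, the polynomials of degree less than `m`, is finite. -/
instance (p m : ℕ) [Fact p.Prime] : Fintype (Polynomial.degreeLT (ZMod p) m) :=
  Fintype.ofEquiv (Fin m → ZMod p) (Polynomial.degreeLTEquiv (ZMod p) m).toEquiv.symm

/-- `r_p(h)` for `h ≠ 0`. -/
def rp (p : ℕ) (h : (ZMod p)[X]) : ℝ :=
  1 / ((p : ℝ) ^ (h.natDegree + 1) * Real.sin (Real.pi / p * (h.leadingCoeff.val : ℝ)) ^ 2)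

open Classical in
/-- `r_p(h, γ)`. -/
def rpWeighted (p : ℕ) (h : (ZMod p)[X]) (c : ℝ) : ℝ :=
  if h = 0 then 1 + c else c * rp p h

open Classical in
/-- `R_γ^d(g, f)` for a modulus `f` of degree `m`. -/
def Rsum (p : ℕ) [Fact p.Prime] (m : ℕ) (f : (ZMod p)[X]) (γ : ℕ → ℝ) {d : ℕ}
    (g : Fin d → (ZMod p)[X]) : ℝ :=
  ∑ h : Fin d → Polynomial.degreeLT (ZMod p) m with
      h ≠ 0 ∧ f ∣ ∑ i, (h i : (ZMod p)[X]) * g i,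
    ∏ i, rpWeighted p (h i) (γ i)

/-- The reduced search set `𝒢_{p,m-w}(f)`. -/
def searchSet (p m w : ℕ) (f : (ZMod p)[X]) : Set (ZMod p)[X] :=
  if w < m then {g | g.degree < ((m - w : ℕ) : WithBot ℕ) ∧ IsCoprime g f} else {1}

/-- The generating vector `(x^{w_1} g_1, …, x^{w_s} g_s)`. -/
def genVector {p s : ℕ} (w : ℕ → ℕ) (g : Fin s → (ZMod p)[X]) : Fin s → (ZMod p)[X] :=
  fun i => Polynomial.X ^ w i * g i

/-- The first `d + 1` entries of a vector. -/
def initial {α : Type*} {s : ℕ} (v : Fin s → α) (d : Fin s) : Fin (d.1 + 1) → α :=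
  fun i => v (Fin.castLE d.isLt i)

/-- `g` is a possible output of the reduced component-by-component algorithm: `g_1 = 1`, and every
later component minimises, over its search set and with the previous components fixed, the
quantity `R_γ` of the generating vector up to that component. -/
structure IsReducedCBC (p : ℕ) [Fact p.Prime] (m : ℕ) (f : (ZMod p)[X]) (γ : ℕ → ℝ) (w : ℕ → ℕ)
    {s : ℕ} (g : Fin s → (ZMod p)[X]) : Prop where
  mem : ∀ d : Fin s, g d ∈ searchSet p m (w d) f
  first : ∀ d : Fin s, d.1 = 0 → g d = 1
  minimal : ∀ d : Fin s, 1 ≤ d.1 → ∀ q ∈ searchSet p m (w d) f,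
    Rsum p m f γ (initial (genVector w g) d) ≤
      Rsum p m f γ (initial (genVector w (Function.update g d q)) d)

end Construction

end

end PolyLattice

namespace PolyLattice

/-! Two estimates are combined: discrepancy is at most `Rsum` plus a rounding error, and
minimisation keeps `Rsum` small.

Discrepancy. The maps `a ↦ ψ([x^(m-1)] h a)`, with `h` of degree less than `m`, are the characters
of `F_p[x]/(x^m)`. Expanding the indicator of a box with corners on the grid `p^(-m) ℤ` in these
characters and averaging over the lattice leaves only the dual vectors `x^m ∣ ∑ h_i q_i`; the zero
vector contributes the volume. A nonzero index has coefficient at most `rp p h`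
(`norm_walshCoeff_le`), and for a full side this coefficient vanishes, so the weighted error is at
most `Rsum` (`weighted_box_le_Rsum`). Rounding a general corner up to the grid costs `γ_u |u| /
p^m`, and `γ_u |u|` is bounded because `∑ γ_j` converges.

Minimisation. A minimum is at most the average over the search set. When a component is appended,
the vectors with last entry zero reproduce the old sum times `1 + γ_d`. For the others one averages
over `g` the number of solutions of `H + a x^w g ≡ 0` modulo `x^m`; weighted by `rp p a`, this is
`O(m p^w / p^m)` uniformly in `H` (`sum_rp_mul_card_le`). By induction `Rsum` is at most `p^(-m) ∏
(1 + γ_i + γ_i p^(w_i) p m S)`, where `S = sinSum p`.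

Since `∑ γ_i p^(w_i)` converges, this product grows subexponentially in `m`, uniformly in the number
of factors (`exists_prod_one_add_mul_le`), hence is `O(N^δ)` with `N = p^m`. Tractability is the
case `δ = 1/2`. -/

open Polynomial in
theorem card_degreeLT (p m : ℕ) [Fact p.Prime] :
    Fintype.card (degreeLT (ZMod p) m) = p ^ m := by
  rw [Fintype.card_congr (degreeLTEquiv (ZMod p) m).toEquiv]
  simp [ZMod.card]

/-- The integer `∑_{i < m} a_i p^i`, where the coefficients `a_i` are read in `{0, …, p - 1}`. -/
def polyVal (p m : ℕ) (a : (ZMod p)[X]) : ℕ :=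
  ∑ i ∈ Finset.range m, (a.coeff i).val * p ^ i

/-! ### Base-`p` digits and polynomials modulo `x^m` -/

section Digits

variable {p : ℕ}

theorem coeff_digitPoly (m n i : ℕ) :
    (digitPoly p m n).coeff i = if i < m then ((n / p ^ i % p : ℕ) : ZMod p) else 0 := by
  simp [digitPoly, Polynomial.finsetSum_coeff, Polynomial.coeff_X_pow]

theorem digitPoly_mem_degreeLT (m n : ℕ) :
    digitPoly p m n ∈ Polynomial.degreeLT (ZMod p) m := by
  rw [Polynomial.mem_degreeLT, Polynomial.degree_lt_iff_coeff_zero]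
  intro i hi
  rw [coeff_digitPoly, if_neg (by omega)]

theorem sum_digits_eq_mod (m n : ℕ) :
    ∑ i ∈ Finset.range m, n / p ^ i % p * p ^ i = n % p ^ m := by
  induction m with
  | zero => simp [Nat.mod_one]
  | succ m ih => rw [Finset.sum_range_succ, ih, Nat.mod_pow_succ, mul_comm]

/-- The pairing of a sequence with the base-`p` digits of `n`, most significant digit first. -/
def digitPairing (p m : ℕ) (c : ℕ → ZMod p) (n : ℕ) : ZMod p :=
  ∑ i ∈ Finset.range m, c i * ((n / p ^ (m - 1 - i) % p : ℕ) : ZMod p)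

theorem digitPairing_succ (m : ℕ) (c : ℕ → ZMod p) (n : ℕ) :
    digitPairing p (m + 1) c n = digitPairing p m c (n / p) + c m * (n : ZMod p) := by
  rw [digitPairing, Finset.sum_range_succ, digitPairing]
  congr 1
  · refine Finset.sum_congr rfl fun i hi => ?_
    have := Finset.mem_range.1 hi
    rw [Nat.div_div_eq_div_mul, ← pow_succ', show m + 1 - 1 - i = m - 1 - i + 1 by omega]
  · simp

theorem coeff_mul_digitPoly {m : ℕ} (hm : 1 ≤ m) (h : (ZMod p)[X]) (n : ℕ) :
    (h * digitPoly p m n).coeff (m - 1) = digitPairing p m h.coeff n := by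
  rw [Polynomial.coeff_mul, Finset.Nat.sum_antidiagonal_eq_sum_range_succ
    (fun i j => h.coeff i * (digitPoly p m n).coeff j), digitPairing,
    show (m - 1).succ = m by omega]
  refine Finset.sum_congr rfl fun i hi => ?_
  have := Finset.mem_range.1 hi
  rw [coeff_digitPoly, if_pos (by omega)]

theorem sum_range_mul_add {M : Type*} [AddCommMonoid M] (F : ℕ → M) (k κ : ℕ) :
    ∑ n ∈ Finset.range (p * k + κ), F n = ∑ l ∈ Finset.range k, ∑ j ∈ Finset.range p, F (p * l + j)
      + ∑ j ∈ Finset.range κ, F (p * k + j) := by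
  rw [Finset.sum_range_add]
  congr 1
  induction k with
  | zero => simp
  | succ k ih => rw [mul_add, mul_one, Finset.sum_range_add, ih, Finset.sum_range_succ]

variable [Fact p.Prime]

theorem polyVal_congr {m : ℕ} {a b : (ZMod p)[X]} (h : Polynomial.X ^ m ∣ a - b) :
    polyVal p m a = polyVal p m b := by
  rw [Polynomial.X_pow_dvd_iff] at h
  refine Finset.sum_congr rfl fun i hi => ?_
  have := h i (Finset.mem_range.1 hi)
  rw [Polynomial.coeff_sub, sub_eq_zero] at this
  rw [this]

theorem polyVal_digitPoly {m n : ℕ} (hn : n < p ^ m) :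
    polyVal p m (digitPoly p m n) = n := by
  have : NeZero p := ⟨(Fact.out : p.Prime).ne_zero⟩
  conv_rhs => rw [← Nat.mod_eq_of_lt hn, ← sum_digits_eq_mod]
  refine Finset.sum_congr rfl fun i hi => ?_
  rw [coeff_digitPoly, if_pos (Finset.mem_range.1 hi), ZMod.val_natCast, Nat.mod_mod]

theorem polyVal_lt (m : ℕ) (a : (ZMod p)[X]) : polyVal p m a < p ^ m := by
  have : NeZero p := ⟨(Fact.out : p.Prime).ne_zero⟩
  induction m with
  | zero => simp [polyVal]
  | succ m ih =>
    rw [polyVal, Finset.sum_range_succ, ← polyVal]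
    have h1 : (a.coeff m).val + 1 ≤ p := ZMod.val_lt _
    calc _ < p ^ m + (a.coeff m).val * p ^ m := by omega
      _ = ((a.coeff m).val + 1) * p ^ m := by ring
      _ ≤ p * p ^ m := Nat.mul_le_mul_right _ h1
      _ = p ^ (m + 1) := by ring

theorem digit_polyVal {m r : ℕ} (hr : r < m) (a : (ZMod p)[X]) :
    polyVal p m a / p ^ r % p = (a.coeff r).val := by
  have hp : 0 < p := (Fact.out : p.Prime).pos
  have : NeZero p := ⟨hp.ne'⟩
  induction m with
  | zero => omega
  | succ m ih =>
    rw [polyVal, Finset.sum_range_succ, ← polyVal]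
    rcases Nat.lt_succ_iff_lt_or_eq.1 hr with h | rfl
    · obtain ⟨k, rfl⟩ : ∃ k, m = r + 1 + k := ⟨m - (r + 1), by omega⟩
      rw [show (a.coeff (r + 1 + k)).val * p ^ (r + 1 + k)
          = p ^ r * (p * ((a.coeff (r + 1 + k)).val * p ^ k)) by ring,
        Nat.add_mul_div_left _ _ (pow_pos hp _), Nat.add_mul_mod_self_left, ih h]
    · rw [mul_comm, Nat.add_mul_div_left _ _ (pow_pos hp _), Nat.div_eq_of_lt (polyVal_lt _ _),
        zero_add, Nat.mod_eq_of_lt (ZMod.val_lt _)]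

/-- Turns equality of integers into a congruence modulo `x^m`, which character sums can detect. -/
theorem X_pow_dvd_sub_digitPoly_iff {m n : ℕ} (hn : n < p ^ m) (a : (ZMod p)[X]) :
    Polynomial.X ^ m ∣ a - digitPoly p m n ↔ polyVal p m a = n := by
  have : NeZero p := ⟨(Fact.out : p.Prime).ne_zero⟩
  constructor
  · intro h
    rw [polyVal_congr h, polyVal_digitPoly hn]
  · rintro rfl
    rw [Polynomial.X_pow_dvd_iff]
    intro i hi
    rw [Polynomial.coeff_sub, coeff_digitPoly, if_pos hi, digit_polyVal hi, ZMod.natCast_zmod_val,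
      sub_self]

/-- The digit polynomials of `0, …, p^m - 1` are the polynomials of degree less than `m`. -/
theorem sum_digitPoly {M : Type*} [AddCommMonoid M] (m : ℕ) (F : (ZMod p)[X] → M) :
    ∑ n : Fin (p ^ m), F (digitPoly p m n) = ∑ h : Polynomial.degreeLT (ZMod p) m, F h := by
  let e : Fin (p ^ m) → Polynomial.degreeLT (ZMod p) m :=
    fun n => ⟨digitPoly p m n, digitPoly_mem_degreeLT m n⟩
  have he : Function.Bijective e := by
    rw [Fintype.bijective_iff_injective_and_card]
    refine ⟨fun a b hab => ?_, by rw [card_degreeLT, Fintype.card_fin]⟩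
    have h : digitPoly p m a = digitPoly p m b := congrArg Subtype.val hab
    exact Fin.ext (by rw [← polyVal_digitPoly a.2, h, polyVal_digitPoly b.2])
  exact Fintype.sum_bijective e he _ _ fun _ => rfl

end Digits

/-! ### Characters and Walsh coefficients of intervals -/

section Characters

variable {p : ℕ} [Fact p.Prime]

open Classical in
/-- Orthogonality of the characters `h ↦ ψ ([x^{m-1}] (h H))` on the polynomials of degree less than
`m`. -/
theorem sum_stdAddChar_coeff {m : ℕ} (hm : 1 ≤ m) (H : (ZMod p)[X]) :
    ∑ h : Polynomial.degreeLT (ZMod p) m, ZMod.stdAddChar (((h : (ZMod p)[X]) * H).coeff (m - 1))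
      = if Polynomial.X ^ m ∣ H then (p : ℂ) ^ m else 0 := by
  let f : Polynomial.degreeLT (ZMod p) m →ₗ[ZMod p] ZMod p :=
    Polynomial.lcoeff (ZMod p) (m - 1) ∘ₗ LinearMap.mulRight (ZMod p) H ∘ₗ Submodule.subtype _
  let χ : AddChar (Polynomial.degreeLT (ZMod p) m) ℂ :=
    ZMod.stdAddChar.compAddMonoidHom f.toAddMonoidHom
  have hχ : χ = 0 ↔ Polynomial.X ^ m ∣ H := by
    constructor
    · intro h0
      rw [Polynomial.X_pow_dvd_iff]
      intro d hd
      -- Testing triviality on the monomial `X^(m-1-d)` reads off the coefficient of `H` at `d`.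
      have hmem : (Polynomial.X : (ZMod p)[X]) ^ (m - 1 - d) ∈ Polynomial.degreeLT (ZMod p) m := by
        rw [Polynomial.mem_degreeLT, Polynomial.degree_X_pow]
        exact_mod_cast (by omega : m - 1 - d < m)
      have h1 : χ ⟨_, hmem⟩ = 1 := by rw [h0]; rfl
      have h2 : ZMod.stdAddChar ((Polynomial.X ^ (m - 1 - d) * H).coeff (m - 1)) = 1 := h1
      rw [Polynomial.coeff_X_pow_mul', if_pos (by omega),
        ← AddChar.map_zero_eq_one (ZMod.stdAddChar (N := p))] at h2
      have := ZMod.injective_stdAddChar h2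
      rwa [show m - 1 - (m - 1 - d) = d by omega] at this
    · rintro ⟨K, rfl⟩
      ext h
      change ZMod.stdAddChar (((h : (ZMod p)[X]) * (Polynomial.X ^ m * K)).coeff (m - 1)) = 1
      rw [mul_left_comm, Polynomial.coeff_X_pow_mul', if_neg (by omega), AddChar.map_zero_eq_one]
  have := AddChar.sum_eq_ite χ
  rw [card_degreeLT] at this
  simp only [hχ] at this
  rw [← Nat.cast_pow]
  exact this

/-- The Walsh coefficient with index `h` of the interval `[0, k / p^m)`. -/
noncomputable def walshCoeff (p m k : ℕ) [Fact p.Prime] (h : (ZMod p)[X]) : ℂ :=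
  ((p : ℂ) ^ m)⁻¹ *
    ∑ n ∈ Finset.range k, ZMod.stdAddChar (-(h * digitPoly p m n).coeff (m - 1))

theorem walshCoeff_zero (m k : ℕ) : walshCoeff p m k 0 = (k : ℂ) / (p : ℂ) ^ m := by
  simp [walshCoeff, div_eq_inv_mul]

theorem walshCoeff_full {m : ℕ} (hm : 1 ≤ m) {h : (ZMod p)[X]}
    (hh : h ∈ Polynomial.degreeLT (ZMod p) m) (h0 : h ≠ 0) : walshCoeff p m (p ^ m) h = 0 := by
  rw [walshCoeff, ← Fin.sum_univ_eq_sum_range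
    (fun n => ZMod.stdAddChar (-(h * digitPoly p m n).coeff (m - 1))),
    sum_digitPoly (p := p) m (fun a => ZMod.stdAddChar (-(h * a).coeff (m - 1)))]
  have := sum_stdAddChar_coeff hm (-h)
  simp only [mul_neg, Polynomial.coeff_neg, dvd_neg, mul_comm _ h] at this
  rw [this, if_neg, mul_zero]
  intro hd
  refine h0 (Polynomial.eq_zero_of_dvd_of_degree_lt ((dvd_neg (α := (ZMod p)[X])).1 hd) ?_)
  rwa [Polynomial.degree_X_pow, ← Polynomial.mem_degreeLT]

/-- Fourier inversion: by orthogonality the sum over `h` keeps only the term with `n` equal to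
`polyVal p m a`. -/
theorem indicator_eq_sum_walshCoeff {m k : ℕ} (hm : 1 ≤ m) (hk : k ≤ p ^ m) (a : (ZMod p)[X]) :
    (if polyVal p m a < k then 1 else 0 : ℂ) = ∑ h : Polynomial.degreeLT (ZMod p) m,
      walshCoeff p m k h * ZMod.stdAddChar (((h : (ZMod p)[X]) * a).coeff (m - 1)) := by
  classical
  have hp : (p : ℂ) ^ m ≠ 0 := pow_ne_zero _ (by exact_mod_cast (Fact.out : p.Prime).ne_zero)
  simp only [walshCoeff, mul_assoc, ← Finset.mul_sum]
  simp only [Finset.sum_mul]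
  rw [Finset.sum_comm]
  have key : ∀ n ∈ Finset.range k, ∑ h : Polynomial.degreeLT (ZMod p) m,
      ZMod.stdAddChar (-((h : (ZMod p)[X]) * digitPoly p m n).coeff (m - 1)) *
        ZMod.stdAddChar (((h : (ZMod p)[X]) * a).coeff (m - 1))
      = if polyVal p m a = n then (p : ℂ) ^ m else 0 := by
    intro n hn
    have h1 := sum_stdAddChar_coeff hm (a - digitPoly p m n)
    rw [← if_congr (X_pow_dvd_sub_digitPoly_iff
      ((Finset.mem_range.1 hn).trans_le hk) a) rfl rfl, ← h1]
    refine Finset.sum_congr rfl fun h _ => ?_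
    rw [← AddChar.map_add_eq_mul, mul_sub, Polynomial.coeff_sub, sub_eq_neg_add]
  rw [Finset.sum_congr rfl key, Finset.sum_ite_eq]
  simp only [Finset.mem_range, mul_ite, mul_zero, inv_mul_cancel₀ hp]

/-- A geometric sum of ratio `z` on the unit circle: the numerator is at most `2`, and `‖z - 1‖ = 2
|sin (π c / p)|`. -/
theorem norm_sum_stdAddChar_mul_le {c : ZMod p} (hc : c ≠ 0) (κ : ℕ) :
    ‖∑ j ∈ Finset.range κ, ZMod.stdAddChar (c * (j : ZMod p))‖
      ≤ 1 / |Real.sin (Real.pi / p * (c.val : ℝ))| := by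
  have h1 : ∀ j : ℕ, ZMod.stdAddChar (c * (j : ZMod p)) = ZMod.stdAddChar c ^ j := fun j => by
    rw [← AddChar.map_nsmul_eq_pow, nsmul_eq_mul, mul_comm]
  have hne : ZMod.stdAddChar c ≠ 1 := fun h => hc <| by
    rw [← AddChar.map_zero_eq_one (ZMod.stdAddChar (N := p))] at h
    exact ZMod.injective_stdAddChar h
  have h2 : ‖ZMod.stdAddChar c - 1‖ = 2 * |Real.sin (Real.pi / p * (c.val : ℝ))| := by
    rw [ZMod.stdAddChar_apply, ZMod.toCircle_apply,
      show (2 * (Real.pi : ℂ) * Complex.I * (c.val : ℂ) / (p : ℂ))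
        = Complex.I * ((2 * (Real.pi / p * (c.val : ℝ)) : ℝ) : ℂ) by push_cast; ring,
      Complex.norm_exp_I_mul_ofReal_sub_one, mul_div_cancel_left₀ _ two_ne_zero, norm_mul,
      Real.norm_eq_abs, Real.norm_eq_abs, abs_two]
  have h3 : 0 < ‖ZMod.stdAddChar c - 1‖ := norm_pos_iff.2 (sub_ne_zero.2 hne)
  have h4 : 0 < |Real.sin (Real.pi / p * (c.val : ℝ))| := by
    rw [h2] at h3; linarith
  simp only [h1]
  rw [geom_sum_eq hne, norm_div, div_le_div_iff₀ h3 h4, h2, one_mul]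
  have h5 : ‖ZMod.stdAddChar c ^ κ - 1‖ ≤ 2 := by
    refine (norm_sub_le _ _).trans ?_
    rw [norm_pow, AddChar.norm_apply, one_pow, norm_one]
    norm_num
  exact mul_le_mul_of_nonneg_right h5 h4.le

/-- The coefficient `c a` meets the digit of `n` at position `e`, and lower digits do not matter.
For `e = 0` complete blocks of `p` consecutive `n` cancel and one geometric sum remains; each
further digit multiplies the bound by `p`. -/
theorem norm_sum_stdAddChar_digitPairing_le (c : ℕ → ZMod p) {a : ℕ} (ha : c a ≠ 0) (e k : ℕ)
    (hc : ∀ i, a < i → i < a + 1 + e → c i = 0) :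
    ‖∑ n ∈ Finset.range k, ZMod.stdAddChar (digitPairing p (a + 1 + e) c n)‖
      ≤ (p : ℝ) ^ e / |Real.sin (Real.pi / p * ((c a).val : ℝ))| := by
  have hp : 0 < p := (Fact.out : p.Prime).pos
  induction e generalizing k with
  | zero =>
    have hsplit : ∀ l j : ℕ, j < p → ZMod.stdAddChar (digitPairing p (a + 1) c (p * l + j))
        = ZMod.stdAddChar (digitPairing p a c l) * ZMod.stdAddChar (c a * (j : ZMod p)) := by
      intro l j hj
      rw [digitPairing_succ, AddChar.map_add_eq_mul, Nat.mul_add_div hp, Nat.div_eq_of_lt hj]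
      simp
    have hfull : ∑ j ∈ Finset.range p, ZMod.stdAddChar (c a * (j : ZMod p)) = 0 := by
      have h1 : ∀ j : ℕ, ZMod.stdAddChar (c a * (j : ZMod p)) = ZMod.stdAddChar (c a) ^ j :=
        fun j => by rw [← AddChar.map_nsmul_eq_pow, nsmul_eq_mul, mul_comm]
      have hne : ZMod.stdAddChar (c a) ≠ 1 := fun h => ha <| by
        rw [← AddChar.map_zero_eq_one (ZMod.stdAddChar (N := p))] at h
        exact ZMod.injective_stdAddChar h
      simp only [h1]
      rw [geom_sum_eq hne, ← h1]
      simp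
    have hk : k = p * (k / p) + k % p := (Nat.div_add_mod k p).symm
    rw [add_zero, hk, sum_range_mul_add, Finset.sum_eq_zero, zero_add,
      Finset.sum_congr rfl fun j hj => hsplit (k / p) j
        ((Finset.mem_range.1 hj).trans (Nat.mod_lt _ hp)), ← Finset.mul_sum, norm_mul,
      AddChar.norm_apply, one_mul, pow_zero]
    · exact norm_sum_stdAddChar_mul_le ha _
    · intro l _
      rw [Finset.sum_congr rfl fun j hj => hsplit l j (Finset.mem_range.1 hj), ← Finset.mul_sum,
        hfull, mul_zero]
  | succ e ih =>
    have ih' := fun k => ih k fun i h1 h2 => hc i h1 (by omega)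
    have hsplit : ∀ l j : ℕ, j < p →
        ZMod.stdAddChar (digitPairing p (a + 1 + (e + 1)) c (p * l + j))
        = ZMod.stdAddChar (digitPairing p (a + 1 + e) c l) := by
      intro l j hj
      rw [← add_assoc, digitPairing_succ, hc (a + 1 + e) (by omega) (by omega), zero_mul, add_zero,
        Nat.mul_add_div hp, Nat.div_eq_of_lt hj, add_zero]
    set T : ℕ → ℂ := fun k =>
      ∑ n ∈ Finset.range k, ZMod.stdAddChar (digitPairing p (a + 1 + e) c n) with hT
    set B := (p : ℝ) ^ e / |Real.sin (Real.pi / p * ((c a).val : ℝ))| with hB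
    have hk : k = p * (k / p) + k % p := (Nat.div_add_mod k p).symm
    have hlt : k % p < p := Nat.mod_lt _ hp
    -- The incomplete last block is absorbed by interpolating between two consecutive partial sums.
    -- The weights add up to `p`, so no additive error accumulates.
    have heq : ∑ n ∈ Finset.range k, ZMod.stdAddChar (digitPairing p (a + 1 + (e + 1)) c n)
        = ((p - k % p : ℕ) : ℂ) * T (k / p) + ((k % p : ℕ) : ℂ) * T (k / p + 1) := by
      conv_lhs => rw [hk]
      rw [sum_range_mul_add, Finset.sum_congr rfl fun l _ => Finset.sum_congr rfl fun j hj =>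
        hsplit l j (Finset.mem_range.1 hj), Finset.sum_congr rfl fun j hj => hsplit (k / p) j
        ((Finset.mem_range.1 hj).trans hlt)]
      simp only [Finset.sum_const, Finset.card_range, nsmul_eq_mul, ← Finset.mul_sum, hT,
        Finset.sum_range_succ]
      push_cast [hlt.le]
      ring
    rw [heq]
    calc _ ≤ ((p - k % p : ℕ) : ℝ) * ‖T (k / p)‖ + ((k % p : ℕ) : ℝ) * ‖T (k / p + 1)‖ := by
          refine (norm_add_le _ _).trans ?_
          rw [norm_mul, norm_mul, Complex.norm_natCast, Complex.norm_natCast]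
      _ ≤ ((p - k % p : ℕ) : ℝ) * B + ((k % p : ℕ) : ℝ) * B := by
          gcongr
          · exact ih' _
          · exact ih' _
      _ = p * B := by push_cast [hlt.le]; ring
      _ = _ := by rw [hB]; ring

theorem sin_pi_div_mul_val_pos {c : ZMod p} (hc : c ≠ 0) :
    0 < Real.sin (Real.pi / p * (c.val : ℝ)) := by
  have hp : (0 : ℝ) < p := by exact_mod_cast (Fact.out : p.Prime).pos
  have : NeZero p := ⟨(Fact.out : p.Prime).ne_zero⟩
  have h1 : (0 : ℝ) < c.val := by
    exact_mod_cast Nat.pos_of_ne_zero fun h => hc ((ZMod.val_eq_zero c).1 h)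
  have h2 : (c.val : ℝ) < p := by exact_mod_cast ZMod.val_lt c
  apply Real.sin_pos_of_pos_of_lt_pi
  · have := Real.pi_pos
    positivity
  · rw [div_mul_eq_mul_div, div_lt_iff₀ hp]
    exact mul_lt_mul_of_pos_left h2 Real.pi_pos

theorem norm_walshCoeff_le {m : ℕ} (hm : 1 ≤ m) (k : ℕ) {h : (ZMod p)[X]}
    (hh : h ∈ Polynomial.degreeLT (ZMod p) m) (h0 : h ≠ 0) : ‖walshCoeff p m k h‖ ≤ rp p h := by
  have hp : (0 : ℝ) < p := by exact_mod_cast (Fact.out : p.Prime).pos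
  have hdeg : h.natDegree < m := by
    rw [Polynomial.mem_degreeLT] at hh
    exact (Polynomial.natDegree_lt_iff_degree_lt h0).2 hh
  have hlc : h.coeff h.natDegree ≠ 0 := by simpa using h0
  obtain ⟨e, he⟩ : ∃ e, m = h.natDegree + 1 + e := ⟨m - (h.natDegree + 1), by omega⟩
  have hs := sin_pi_div_mul_val_pos hlc
  have hb := norm_sum_stdAddChar_digitPairing_le h.coeff hlc e k
    fun i hi _ => Polynomial.coeff_eq_zero_of_natDegree_lt hi
  rw [← he] at hb
  rw [walshCoeff, norm_mul, norm_inv, norm_pow, Complex.norm_natCast]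
  have hconj : ∑ n ∈ Finset.range k, ZMod.stdAddChar (-(h * digitPoly p m n).coeff (m - 1))
      = (starRingEnd ℂ)
        (∑ n ∈ Finset.range k, ZMod.stdAddChar (digitPairing p m h.coeff n)) := by
    rw [map_sum]
    exact Finset.sum_congr rfl fun n _ => by
      rw [coeff_mul_digitPoly hm, AddChar.map_neg_eq_conj]
  rw [hconj, RCLike.norm_conj]
  rw [abs_of_pos hs] at hb
  calc _ ≤ ((p : ℝ) ^ m)⁻¹ *
          ((p : ℝ) ^ e / Real.sin (Real.pi / p * ((h.coeff h.natDegree).val : ℝ))) := by gcongr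
    _ = 1 / ((p : ℝ) ^ (h.natDegree + 1) *
          Real.sin (Real.pi / p * ((h.coeff h.natDegree).val : ℝ))) := by
        rw [he, pow_add _ (h.natDegree + 1) e]; field_simp
    -- The bound with the first power of the sine is better; since the sine is in `(0, 1]`, squaring
    -- it only enlarges the bound.
    _ ≤ rp p h := by
        rw [rp, Polynomial.leadingCoeff]
        refine one_div_le_one_div_of_le (by positivity) ?_
        refine mul_le_mul_of_nonneg_left ?_ (by positivity)
        have := Real.sin_le_one (Real.pi / p * ((h.coeff h.natDegree).val : ℝ))
        nlinarith

end Characters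

/-! ### Lattice points and the Walsh expansion of their discrepancy -/

section Points

variable {p : ℕ} [Fact p.Prime]

theorem toLaurent_X_pow (m : ℕ) :
    toLaurent p (Polynomial.X ^ m) = HahnSeries.single (-(m : ℤ)) (1 : ZMod p) := by
  rw [toLaurent, Polynomial.eval₂_X_pow, HahnSeries.single_pow]
  simp

theorem coeff_toLaurent (a : (ZMod p)[X]) (k : ℕ) :
    (toLaurent p a).coeff (-(k : ℤ)) = a.coeff k := by
  induction a using Polynomial.induction_on' with
  | add a b ha hb => rw [toLaurent, Polynomial.eval₂_add, HahnSeries.coeff_add', Pi.add_apply,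
      Polynomial.coeff_add, ← ha, ← hb, toLaurent, toLaurent]
  | monomial n c =>
    rw [toLaurent, Polynomial.eval₂_monomial, HahnSeries.single_pow, HahnSeries.C_apply,
      HahnSeries.single_mul_single, HahnSeries.coeff_single, Polynomial.coeff_monomial]
    simp [eq_comm]

/-- Division by `x^m` shifts exponents by `m`, and `phi` reads only negative powers of `x`;
coefficients of `a` of index `m` or more are therefore discarded. -/
theorem phi_toLaurent_div (m : ℕ) (a : (ZMod p)[X]) :
    phi p m (toLaurent p a / toLaurent p (Polynomial.X ^ m)) = polyVal p m a / (p : ℝ) ^ m := by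
  have hp : (p : ℝ) ≠ 0 := by exact_mod_cast (Fact.out : p.Prime).ne_zero
  have hdiv : toLaurent p a / toLaurent p (Polynomial.X ^ m)
      = toLaurent p a * HahnSeries.single (m : ℤ) (1 : ZMod p) := by
    have h1 : HahnSeries.single (m : ℤ) (1 : ZMod p) * HahnSeries.single (-(m : ℤ)) (1 : ZMod p)
        = 1 := by
      rw [HahnSeries.single_mul_single]; simp
    rw [toLaurent_X_pow, div_eq_iff (fun h => by simp [h] at h1), mul_assoc, h1, mul_one]
  rw [hdiv, phi, polyVal, Nat.cast_sum, Finset.sum_div]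
  refine Finset.sum_nbij' (fun l => m - l) (fun i => m - i) ?_ ?_ ?_ ?_ ?_
  · intro l hl
    simp only [Finset.mem_Icc, Finset.mem_range] at *
    omega
  · intro l hl
    simp only [Finset.mem_Icc, Finset.mem_range] at *
    omega
  · intro l hl
    simp only [Finset.mem_Icc] at *
    omega
  · intro l hl
    simp only [Finset.mem_range] at *
    omega
  · intro l hl
    simp only [Finset.mem_Icc] at hl
    have h1 : (l : ℤ) = -((m - l : ℕ) : ℤ) + (m : ℤ) := by omega
    rw [h1, HahnSeries.coeff_mul_single_add, mul_one, coeff_toLaurent]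
    push_cast
    rw [mul_div_assoc]
    congr 1
    rw [eq_div_iff (pow_ne_zero _ hp)]
    rw [pow_sub₀ _ hp hl.2, mul_comm]

theorem polyLatticePoints_apply (m : ℕ) {s : ℕ} (q : Fin s → (ZMod p)[X]) (n : Fin (p ^ m))
    (j : Fin s) : polyLatticePoints p m (Polynomial.X ^ m) q n j
      = polyVal p m (digitPoly p m n * q j) / (p : ℝ) ^ m :=
  phi_toLaurent_div m _

theorem polyLatticePoints_mem_Ico (m : ℕ) {s : ℕ} (q : Fin s → (ZMod p)[X]) (n : Fin (p ^ m))
    (j : Fin s) : polyLatticePoints p m (Polynomial.X ^ m) q n j ∈ Set.Ico (0 : ℝ) 1 := by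
  have hp : (0 : ℝ) < p := by exact_mod_cast (Fact.out : p.Prime).pos
  rw [polyLatticePoints_apply]
  refine ⟨by positivity, ?_⟩
  rw [div_lt_one (by positivity)]
  exact_mod_cast polyVal_lt m _

theorem indicator_box_polyLatticePoints (m : ℕ) {s : ℕ} (q : Fin s → (ZMod p)[X])
    (n : Fin (p ^ m)) (t : Fin s → ℝ) :
    (Set.univ.pi fun j => Set.Ico (0 : ℝ) (t j)).indicator (1 : (Fin s → ℝ) → ℝ)
      (polyLatticePoints p m (Polynomial.X ^ m) q n)
      = ∏ j, if polyVal p m (digitPoly p m n * q j) < ⌈t j * (p : ℝ) ^ m⌉₊ then 1 else 0 := by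
  have hp : (0 : ℝ) < (p : ℝ) ^ m :=
    pow_pos (by exact_mod_cast (Fact.out : p.Prime).pos) m
  have key : ∀ j, polyLatticePoints p m (Polynomial.X ^ m) q n j ∈ Set.Ico (0 : ℝ) (t j) ↔
      polyVal p m (digitPoly p m n * q j) < ⌈t j * (p : ℝ) ^ m⌉₊ := by
    intro j
    rw [Nat.lt_ceil, ← div_lt_iff₀ hp, ← polyLatticePoints_apply]
    exact ⟨fun h => h.2, fun h => ⟨(polyLatticePoints_mem_Ico m q n j).1, h⟩⟩
  by_cases hall : ∀ j, polyLatticePoints p m (Polynomial.X ^ m) q n j ∈ Set.Ico (0 : ℝ) (t j)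
  · rw [Set.indicator_of_mem (Set.mem_univ_pi.2 hall), Pi.one_apply, Finset.prod_eq_one]
    exact fun j _ => if_pos ((key j).1 (hall j))
  · rw [Set.indicator_of_notMem (fun h => hall (Set.mem_univ_pi.1 h))]
    push Not at hall
    obtain ⟨j, hj⟩ := hall
    exact (Finset.prod_eq_zero (Finset.mem_univ j) (if_neg fun h => hj ((key j).2 h))).symm

theorem map_sum_eq_prod {A ι M : Type*} [AddCommMonoid A] [CommMonoid M] (ψ : AddChar A M)
    (u : Finset ι) (f : ι → A) : ψ (∑ i ∈ u, f i) = ∏ i ∈ u, ψ (f i) :=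
  map_prod ψ.toMonoidHom (fun i => Multiplicative.ofAdd (f i)) u

open Classical in
/-- The Walsh expansion of the counting function of a box with corners on the grid `p^{-m} ℤ`. -/
theorem sum_box_eq_sum_dual {m : ℕ} (hm : 1 ≤ m) {s : ℕ} (q : Fin s → (ZMod p)[X]) (k : Fin s → ℕ)
    (hk : ∀ j, k j ≤ p ^ m) :
    ((p : ℂ) ^ m)⁻¹ * ∑ n : Fin (p ^ m), ∏ j,
        (if polyVal p m (digitPoly p m n * q j) < k j then 1 else 0 : ℂ)
      = ∑ h : Fin s → Polynomial.degreeLT (ZMod p) m with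
          Polynomial.X ^ m ∣ ∑ i, (h i : (ZMod p)[X]) * q i, ∏ j, walshCoeff p m (k j) (h j) := by
  have hp : (p : ℂ) ^ m ≠ 0 := pow_ne_zero _ (by exact_mod_cast (Fact.out : p.Prime).ne_zero)
  have h1 : ∀ n : Fin (p ^ m), ∏ j,
        (if polyVal p m (digitPoly p m n * q j) < k j then 1 else 0 : ℂ)
      = ∑ h : Fin s → Polynomial.degreeLT (ZMod p) m, (∏ j, walshCoeff p m (k j) (h j)) *
        ZMod.stdAddChar ((digitPoly p m n * ∑ i, (h i : (ZMod p)[X]) * q i).coeff (m - 1)) := by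
    intro n
    simp only [fun j => indicator_eq_sum_walshCoeff hm (hk j) (digitPoly p m n * q j)]
    rw [Fintype.prod_sum]
    refine Finset.sum_congr rfl fun h _ => ?_
    rw [Finset.prod_mul_distrib, Finset.mul_sum, Polynomial.finsetSum_coeff,
      map_sum_eq_prod]
    simp only [mul_left_comm]
  rw [Finset.sum_congr rfl fun n _ => h1 n, Finset.sum_comm, Finset.sum_filter, Finset.mul_sum]
  refine Finset.sum_congr rfl fun h _ => ?_
  rw [← Finset.mul_sum, sum_digitPoly (p := p) m
    (fun a => ZMod.stdAddChar ((a * ∑ i, (h i : (ZMod p)[X]) * q i).coeff (m - 1))),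
    sum_stdAddChar_coeff hm]
  split_ifs
  · rw [mul_comm, mul_assoc, mul_inv_cancel₀ hp, mul_one]
  · simp

open Classical in
theorem sum_box_sub_eq_sum_dual {m : ℕ} (hm : 1 ≤ m) {s : ℕ} (q : Fin s → (ZMod p)[X])
    (k : Fin s → ℕ) (hk : ∀ j, k j ≤ p ^ m) :
    ((((p : ℝ) ^ m)⁻¹ * ∑ n : Fin (p ^ m), ∏ j,
        (if polyVal p m (digitPoly p m n * q j) < k j then 1 else 0 : ℝ)
        - ∏ j, (k j / (p : ℝ) ^ m) : ℝ) : ℂ)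
      = ∑ h : Fin s → Polynomial.degreeLT (ZMod p) m with
          h ≠ 0 ∧ Polynomial.X ^ m ∣ ∑ i, (h i : (ZMod p)[X]) * q i,
          ∏ j, walshCoeff p m (k j) (h j) := by
  push_cast [apply_ite Complex.ofReal]
  rw [sum_box_eq_sum_dual hm q k hk, ← Finset.add_sum_erase _ _
    (show (0 : Fin s → Polynomial.degreeLT (ZMod p) m) ∈ _ by simp)]
  simp only [Pi.zero_apply, ZeroMemClass.coe_zero, walshCoeff_zero, add_sub_cancel_left]
  congr 1
  ext h
  simp

open Classical in
theorem rpWeighted_nonneg (h : (ZMod p)[X]) {c : ℝ} (hc : 0 ≤ c) : 0 ≤ rpWeighted p h c := by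
  rw [rpWeighted]
  split_ifs
  · linarith
  · rw [rp]; positivity

theorem Rsum_nonneg (m : ℕ) (f : (ZMod p)[X]) {γ : ℕ → ℝ} (hγ : ∀ j, 0 ≤ γ j) {d : ℕ}
    (g : Fin d → (ZMod p)[X]) : 0 ≤ Rsum p m f γ g :=
  Finset.sum_nonneg fun _ _ => Finset.prod_nonneg fun _ _ => rpWeighted_nonneg _ (hγ _)

open Classical in
-- The weight is distributed over the coordinates, as `γ_j` inside `u` and `1` outside, and each
-- factor is compared with `rpWeighted`. At index zero both `γ_j` and `1` are at most `1 + γ_j`.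
theorem weighted_box_le_Rsum {m : ℕ} (hm : 1 ≤ m) {γ : ℕ → ℝ} (hγ : ∀ j, 0 ≤ γ j) {s : ℕ}
    (q : Fin s → (ZMod p)[X]) (u : Finset (Fin s)) (k : Fin s → ℕ) (hk : ∀ j, k j ≤ p ^ m)
    (hu : ∀ j, j ∉ u → k j = p ^ m) :
    (∏ j ∈ u, γ j) * |((p : ℝ) ^ m)⁻¹ * ∑ n : Fin (p ^ m), ∏ j,
        (if polyVal p m (digitPoly p m n * q j) < k j then 1 else 0 : ℝ)
        - ∏ j, (k j / (p : ℝ) ^ m)| ≤ Rsum p m (Polynomial.X ^ m) γ q := by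
  have hp : (0 : ℝ) < p := by exact_mod_cast (Fact.out : p.Prime).pos
  rw [← Real.norm_eq_abs, ← Complex.norm_real, sum_box_sub_eq_sum_dual hm q k hk]
  have hprod : (∏ j ∈ u, γ j) = ∏ j, if j ∈ u then γ j else 1 := by
    rw [Finset.prod_ite_mem, Finset.univ_inter]
  have hnn : ∀ j : Fin s, 0 ≤ if j ∈ u then γ j else 1 := fun j => by
    split_ifs
    · exact hγ j
    · exact zero_le_one
  calc _ ≤ (∏ j ∈ u, γ j) * ∑ h : Fin s → Polynomial.degreeLT (ZMod p) m with
          h ≠ 0 ∧ Polynomial.X ^ m ∣ ∑ i, (h i : (ZMod p)[X]) * q i,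
          ∏ j, ‖walshCoeff p m (k j) (h j)‖ := by
        refine mul_le_mul_of_nonneg_left ?_ (Finset.prod_nonneg fun j _ => hγ j)
        refine (norm_sum_le _ _).trans_eq ?_
        simp only [norm_prod]
    _ ≤ _ := by
        rw [Finset.mul_sum, Rsum]
        refine Finset.sum_le_sum fun h _ => ?_
        rw [hprod, ← Finset.prod_mul_distrib]
        refine Finset.prod_le_prod (fun j _ => mul_nonneg (hnn j) (norm_nonneg _)) fun j _ => ?_
        have hγj := hγ j
        rw [rpWeighted]
        by_cases h0 : (h j : (ZMod p)[X]) = 0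
        · have hle : ‖walshCoeff p m (k j) (h j)‖ ≤ 1 := by
            rw [h0, walshCoeff_zero, norm_div, norm_pow, Complex.norm_natCast,
              Complex.norm_natCast]
            exact div_le_one_of_le₀ (by exact_mod_cast hk j) (by positivity)
          rw [if_pos h0]
          refine (mul_le_of_le_one_right (hnn j) hle).trans ?_
          split_ifs <;> linarith
        · rw [if_neg h0]
          by_cases hj : j ∈ u
          · rw [if_pos hj]
            exact mul_le_mul_of_nonneg_left (norm_walshCoeff_le hm _ (h j).2 h0) hγj
          · rw [hu j hj, walshCoeff_full hm (h j).2 h0, norm_zero, mul_zero, rp]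
            positivity

end Points

/-! ### Rounding box corners to the grid -/

theorem prod_sub_prod_le_sum {ι : Type*} (u : Finset ι) (a b : ι → ℝ) (ha : ∀ i ∈ u, 0 ≤ a i)
    (hab : ∀ i ∈ u, a i ≤ b i) (hb : ∀ i ∈ u, b i ≤ 1) :
    ∏ i ∈ u, b i - ∏ i ∈ u, a i ≤ ∑ i ∈ u, (b i - a i) := by
  classical
  induction u using Finset.induction_on with
  | empty => simp
  | insert i u hi ih =>
    simp only [Finset.forall_mem_insert] at ha hab hb
    rw [Finset.prod_insert hi, Finset.prod_insert hi, Finset.sum_insert hi]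
    have h1 := ih ha.2 hab.2 hb.2
    have h2 : ∏ i ∈ u, b i ≤ 1 :=
      Finset.prod_le_one (fun j hj => (ha.2 j hj).trans (hab.2 j hj)) hb.2
    have h3 : ∏ i ∈ u, a i ≤ ∏ i ∈ u, b i := Finset.prod_le_prod ha.2 hab.2
    nlinarith [ha.1, hab.1, hb.1]

theorem weightedStarDisc_le {p : ℕ} [Fact p.Prime] {m : ℕ} (hm : 1 ≤ m) {γ : ℕ → ℝ}
    (hγ : ∀ j, 0 ≤ γ j) {s : ℕ} (q : Fin s → (ZMod p)[X]) {E : ℝ}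
    (hE : ∀ u : Finset (Fin s), (∏ j ∈ u, γ j) * u.card ≤ E) :
    weightedStarDisc γ (polyLatticePoints p m (Polynomial.X ^ m) q)
      ≤ Rsum p m (Polynomial.X ^ m) γ q + E / (p : ℝ) ^ m := by
  have hp : (0 : ℝ) < p := by exact_mod_cast (Fact.out : p.Prime).pos
  have hN : (0 : ℝ) < (p : ℝ) ^ m := pow_pos hp m
  have hE0 : 0 ≤ E := by simpa using hE ∅
  have hnn : 0 ≤ Rsum p m (Polynomial.X ^ m) γ q + E / (p : ℝ) ^ m :=
    add_nonneg (Rsum_nonneg m _ hγ q) (by positivity)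
  -- Nonnegativity of the bound is needed because a real supremum over an empty family is `0`; this
  -- occurs for `s = 0`, where no nonempty `u` exists.
  refine Real.iSup_le (fun t => Real.iSup_le (fun u => ?_) hnn) hnn
  obtain ⟨t, ht⟩ := t
  obtain ⟨u, -⟩ := u
  simp only
  set t' : Fin s → ℝ := fun j => if j ∈ u then t j else 1 with ht'
  -- Points on the grid lie below `t' j` exactly when their numerator lies below this ceiling, so
  -- rounding up changes the volume but not the count.
  set k : Fin s → ℕ := fun j => ⌈t' j * (p : ℝ) ^ m⌉₊ with hkdef
  have ht'0 : ∀ j, 0 < t' j := fun j => by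
    rw [ht']; dsimp only; split_ifs
    · exact (ht j).1
    · exact zero_lt_one
  have ht'1 : ∀ j, t' j ≤ 1 := fun j => by
    rw [ht']; dsimp only; split_ifs
    · exact (ht j).2
    · exact le_rfl
  have hk : ∀ j, k j ≤ p ^ m := fun j => by
    refine Nat.ceil_le.2 ?_
    push_cast
    exact mul_le_of_le_one_left hN.le (ht'1 j)
  have hku : ∀ j, j ∉ u → k j = p ^ m := fun j hj => by
    simp only [hkdef, ht', if_neg hj, one_mul]
    exact_mod_cast Nat.ceil_natCast (R := ℝ) (p ^ m)
  have hle : ∀ j, t' j ≤ k j / (p : ℝ) ^ m := fun j => by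
    rw [le_div_iff₀ hN]; exact Nat.le_ceil _
  have hk1 : ∀ j, k j / (p : ℝ) ^ m ≤ 1 := fun j => by
    rw [div_le_one hN]; exact_mod_cast hk j
  have hsplit : localDisc (polyLatticePoints p m (Polynomial.X ^ m) q) t'
      = (((p : ℝ) ^ m)⁻¹ * ∑ n : Fin (p ^ m), ∏ j,
        (if polyVal p m (digitPoly p m n * q j) < k j then 1 else 0 : ℝ)
        - ∏ j, (k j / (p : ℝ) ^ m)) + (∏ j, (k j / (p : ℝ) ^ m) - ∏ j, t' j) := by
    rw [localDisc]
    simp only [indicator_box_polyLatticePoints]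
    push_cast
    ring
  have hround : |∏ j, (k j / (p : ℝ) ^ m) - ∏ j, t' j| ≤ u.card / (p : ℝ) ^ m := by
    rw [abs_of_nonneg (sub_nonneg.2 (Finset.prod_le_prod (fun j _ => (ht'0 j).le)
      fun j _ => hle j))]
    refine (prod_sub_prod_le_sum _ _ _ (fun j _ => (ht'0 j).le) (fun j _ => hle j)
      fun j _ => hk1 j).trans ?_
    calc ∑ j, (k j / (p : ℝ) ^ m - t' j) ≤ ∑ j, if j ∈ u then 1 / (p : ℝ) ^ m else 0 := by
          refine Finset.sum_le_sum fun j _ => ?_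
          split_ifs with hj
          · have h1 := (Nat.ceil_lt_add_one (a := t' j * (p : ℝ) ^ m)
              (mul_nonneg (ht'0 j).le hN.le)).le
            rw [sub_le_iff_le_add, div_add' _ _ _ hN.ne', div_le_div_iff_of_pos_right hN]
            linarith
          · rw [hku j hj, ht']
            simp only [if_neg hj]
            push_cast
            rw [div_self hN.ne', sub_self]
      _ = u.card / (p : ℝ) ^ m := by
          rw [Finset.sum_ite_mem, Finset.univ_inter, Finset.sum_const, nsmul_eq_mul, mul_one_div]
  have hγu : 0 ≤ ∏ j ∈ u, γ j := Finset.prod_nonneg fun j _ => hγ j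
  rw [hsplit]
  refine (mul_le_mul_of_nonneg_left (abs_add_le _ _) hγu).trans ?_
  rw [mul_add]
  refine add_le_add (weighted_box_le_Rsum hm hγ q u k hk hku) ?_
  calc _ ≤ (∏ j ∈ u, γ j) * (u.card / (p : ℝ) ^ m) := mul_le_mul_of_nonneg_left hround hγu
    _ = (∏ j ∈ u, γ j) * u.card / (p : ℝ) ^ m := by ring
    _ ≤ _ := by gcongr; exact hE u

/-- The sum of `sin^{-2}(π c / p)` over the residues `c` modulo `p`. -/
noncomputable def sinSum (p : ℕ) [Fact p.Prime] : ℝ :=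
  ∑ c : ZMod p, 1 / Real.sin (Real.pi / p * (c.val : ℝ)) ^ 2

/-! ### Sums of the kernel `rp` -/

section Kernel

variable {p : ℕ} [Fact p.Prime]

theorem sinSum_nonneg : 0 ≤ sinSum p :=
  Finset.sum_nonneg fun _ _ => by positivity

theorem rp_nonneg (h : (ZMod p)[X]) : 0 ≤ rp p h := by
  rw [rp]; positivity

theorem rp_le (h : (ZMod p)[X]) : rp p h ≤ sinSum p / (p : ℝ) ^ (h.natDegree + 1) := by
  rw [rp, mul_comm, ← div_div]
  gcongr
  exact Finset.single_le_sum (f := fun c : ZMod p => 1 / Real.sin (Real.pi / p * (c.val : ℝ)) ^ 2)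
    (fun _ _ => by positivity) (Finset.mem_univ _)

theorem rp_X_pow_mul (e : ℕ) {b : (ZMod p)[X]} (hb : b ≠ 0) :
    rp p (Polynomial.X ^ e * b) = rp p b / (p : ℝ) ^ e := by
  rw [rp, rp, Polynomial.natDegree_X_pow_mul e hb, Polynomial.leadingCoeff_mul,
    Polynomial.leadingCoeff_X_pow, one_mul, div_div]
  ring

open Classical in
theorem card_natDegree_eq_le (m k : ℕ) :
    (Finset.univ.filter fun a : Polynomial.degreeLT (ZMod p) m =>
      (a : (ZMod p)[X]).natDegree = k).card ≤ p ^ (k + 1) := by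
  rw [← card_degreeLT p (k + 1), ← Fintype.card_subtype]
  refine Fintype.card_le_of_injective (fun a => ⟨a.1.1, ?_⟩) fun a b hab => ?_
  · rw [Polynomial.mem_degreeLT]
    refine Polynomial.degree_le_natDegree.trans_lt ?_
    rw [a.2]
    exact_mod_cast Nat.lt_succ_self k
  · exact Subtype.ext (Subtype.ext (Subtype.mk.inj hab))

open Classical in
-- There are at most `p^(k+1)` polynomials of degree `k`, each of weight at most `sinSum p /
-- p^(k+1)`; so each of the `m` degrees contributes at most `sinSum p`.
theorem sum_rp_le (m : ℕ) :
    ∑ a ∈ Finset.univ.filter (fun a : Polynomial.degreeLT (ZMod p) m =>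
      a ≠ 0), rp p a ≤ m * sinSum p := by
  have hp : (0 : ℝ) < p := by exact_mod_cast (Fact.out : p.Prime).pos
  rw [← Finset.sum_fiberwise_of_maps_to (t := Finset.range m)
    (g := fun a : Polynomial.degreeLT (ZMod p) m => (a : (ZMod p)[X]).natDegree)]
  · calc _ ≤ ∑ _k ∈ Finset.range m, sinSum p := by
          refine Finset.sum_le_sum fun k _ => ?_
          calc _ ≤ ∑ a ∈ Finset.univ.filter (fun a : Polynomial.degreeLT (ZMod p) m =>
      (a : (ZMod p)[X]).natDegree = k),
                  sinSum p / (p : ℝ) ^ (k + 1) := by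
                refine (Finset.sum_le_sum fun a ha => ?_).trans
                  (Finset.sum_le_sum_of_subset_of_nonneg
                    (Finset.filter_subset_filter _ (Finset.subset_univ _)) fun _ _ _ => ?_)
                · rw [← (Finset.mem_filter.1 ha).2]
                  exact rp_le _
                · exact div_nonneg sinSum_nonneg (by positivity)
            _ ≤ (p : ℝ) ^ (k + 1) * (sinSum p / (p : ℝ) ^ (k + 1)) := by
                rw [Finset.sum_const, nsmul_eq_mul]
                refine mul_le_mul_of_nonneg_right ?_ (div_nonneg sinSum_nonneg (by positivity))
                exact_mod_cast card_natDegree_eq_le m k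
            _ = sinSum p := by field_simp
      _ = m * sinSum p := by simp
  · intro a ha
    have h0 : (a : (ZMod p)[X]) ≠ 0 := fun h => (Finset.mem_filter.1 ha).2 (Subtype.ext h)
    rw [Finset.mem_range, Polynomial.natDegree_lt_iff_degree_lt h0, ← Polynomial.mem_degreeLT]
    exact a.2

open Classical in
-- Division by `X^e` is injective on multiples of `X^e` and multiplies the weight by `p^e`.
theorem sum_rp_dvd_le (m e : ℕ) :
    ∑ a ∈ Finset.univ.filter (fun a : Polynomial.degreeLT (ZMod p) m =>
      a ≠ 0 ∧ Polynomial.X ^ e ∣ (a : (ZMod p)[X])), rp p a ≤ m * sinSum p / (p : ℝ) ^ e := by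
  have hp : (0 : ℝ) < p := by exact_mod_cast (Fact.out : p.Prime).pos
  have hmon : (Polynomial.X ^ e : (ZMod p)[X]).Monic := Polynomial.monic_X_pow e
  let φ : Polynomial.degreeLT (ZMod p) m → Polynomial.degreeLT (ZMod p) m := fun a =>
    ⟨(a : (ZMod p)[X]) /ₘ Polynomial.X ^ e, by
      rw [Polynomial.mem_degreeLT]
      exact (Polynomial.degree_divByMonic_le _ _).trans_lt (Polynomial.mem_degreeLT.1 a.2)⟩
  have hφ : ∀ a : Polynomial.degreeLT (ZMod p) m, Polynomial.X ^ e ∣ (a : (ZMod p)[X]) →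
      (a : (ZMod p)[X]) = Polynomial.X ^ e * (φ a : (ZMod p)[X]) := by
    rintro a ⟨c, hc⟩
    change (a : (ZMod p)[X]) = Polynomial.X ^ e * ((a : (ZMod p)[X]) /ₘ Polynomial.X ^ e)
    rw [hc, Polynomial.mul_divByMonic_cancel_left _ hmon]
  have hφ0 : ∀ a : Polynomial.degreeLT (ZMod p) m, a ≠ 0 → Polynomial.X ^ e ∣ (a : (ZMod p)[X]) →
      (φ a : (ZMod p)[X]) ≠ 0 := fun a h0 hd h => h0 <| Subtype.ext <| by
    rw [hφ a hd, h, mul_zero]; rfl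
  set S := Finset.univ.filter fun a : Polynomial.degreeLT (ZMod p) m =>
    a ≠ 0 ∧ Polynomial.X ^ e ∣ (a : (ZMod p)[X]) with hS
  have hinj : Set.InjOn φ S := by
    intro a ha b hb hab
    simp only [hS, Finset.coe_filter, Finset.mem_univ, true_and, Set.mem_ofPred_eq] at ha hb
    exact Subtype.ext (by rw [hφ a ha.2, hφ b hb.2, hab])
  calc _ = ∑ a ∈ S, rp p (φ a) / (p : ℝ) ^ e := by
        refine Finset.sum_congr rfl fun a ha => ?_
        have ha' := (Finset.mem_filter.1 ha).2
        conv_lhs => rw [hφ a ha'.2]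
        rw [rp_X_pow_mul e (hφ0 a ha'.1 ha'.2)]
    _ = (∑ b ∈ S.image φ, rp p b) / (p : ℝ) ^ e := by
        rw [Finset.sum_image hinj, Finset.sum_div]
    _ ≤ (∑ b ∈ Finset.univ.filter (fun b : Polynomial.degreeLT (ZMod p) m =>
      b ≠ 0), rp p b) / (p : ℝ) ^ e := by
        gcongr
        · exact fun _ _ _ => rp_nonneg _
        · intro b hb
          obtain ⟨a, ha, rfl⟩ := Finset.mem_image.1 hb
          have ha' := (Finset.mem_filter.1 ha).2
          exact Finset.mem_filter.2 ⟨Finset.mem_univ _, fun h => hφ0 a ha'.1 ha'.2 (by rw [h]; rfl)⟩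
    _ ≤ _ := by gcongr; exact sum_rp_le m

end Kernel

/-! ### Averaging over the search set -/

section SearchSet

variable {p : ℕ} [Fact p.Prime]

theorem searchSet_finite (m w : ℕ) (f : (ZMod p)[X]) : (searchSet p m w f).Finite := by
  rw [searchSet]
  split_ifs
  · refine Set.Finite.subset (Set.finite_range
      (Subtype.val : Polynomial.degreeLT (ZMod p) (m - w) → (ZMod p)[X])) fun g hg => ?_
    exact ⟨⟨g, Polynomial.mem_degreeLT.2 hg.1⟩, rfl⟩
  · exact Set.finite_singleton 1

/-- The reduced search set for the modulus `x^m` as a finite set. -/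
noncomputable def searchFinset (p m w : ℕ) [Fact p.Prime] : Finset (ZMod p)[X] :=
  (searchSet_finite m w (Polynomial.X ^ m)).toFinset

theorem mem_searchFinset {m w : ℕ} {g : (ZMod p)[X]} :
    g ∈ searchFinset p m w ↔ g ∈ searchSet p m w (Polynomial.X ^ m) :=
  Set.Finite.mem_toFinset _

theorem one_mem_searchSet (m w : ℕ) (f : (ZMod p)[X]) : 1 ∈ searchSet p m w f := by
  rw [searchSet]
  split_ifs with h
  · refine ⟨?_, isCoprime_one_left⟩
    rw [Polynomial.degree_one]
    exact_mod_cast (by omega : 0 < m - w)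
  · rfl

theorem card_searchFinset_pos (m w : ℕ) : 0 < (searchFinset p m w).card :=
  Finset.card_pos.2 ⟨1, mem_searchFinset.2 (one_mem_searchSet _ _ _)⟩

/-- Polynomials with constant term `1` are coprime to `X`; they already suffice. -/
theorem le_card_searchFinset {m w : ℕ} (h : w < m) :
    p ^ (m - w - 1) ≤ (searchFinset p m w).card := by
  rw [← card_degreeLT p (m - w - 1), ← Fintype.card_coe]
  refine Fintype.card_le_of_injective (fun b => ⟨1 + Polynomial.X * (b : (ZMod p)[X]), ?_⟩)
    fun a b hab => ?_
  · rw [mem_searchFinset, searchSet, if_pos h]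
    have hb := Polynomial.mem_degreeLT.1 b.2
    constructor
    · rw [Polynomial.degree_lt_iff_coeff_zero] at hb ⊢
      intro i hi
      obtain ⟨i, rfl⟩ : ∃ j, i = j + 1 := ⟨i - 1, by omega⟩
      rw [Polynomial.coeff_add, Polynomial.coeff_X_mul, hb i (by omega), Polynomial.coeff_one,
        if_neg (by omega), add_zero]
    · exact IsCoprime.pow_right ⟨1, -(b : (ZMod p)[X]), by ring⟩
  · have h1 : 1 + Polynomial.X * (a : (ZMod p)[X]) = 1 + Polynomial.X * (b : (ZMod p)[X]) :=
      congrArg Subtype.val hab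
    exact Subtype.ext (mul_left_cancel₀ Polynomial.X_ne_zero (add_left_cancel h1))

theorem isCoprime_X_pow_of_not_dvd {b : (ZMod p)[X]} (h : ¬ Polynomial.X ∣ b) (k : ℕ) :
    IsCoprime (Polynomial.X ^ k) b :=
  IsCoprime.pow_left ((Polynomial.irreducible_X.coprime_iff_not_dvd).2 h)

theorem isCoprime_X_of_mem_searchFinset {m w : ℕ} (h : w < m) {g : (ZMod p)[X]}
    (hg : g ∈ searchFinset p m w) : IsCoprime g Polynomial.X := by
  rw [mem_searchFinset, searchSet, if_pos h] at hg
  exact (IsCoprime.pow_right_iff (by omega)).1 hg.2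

theorem X_pow_dvd_of_dvd_mul_X_pow_mul {m w : ℕ} (h : w ≤ m) {c : (ZMod p)[X]}
    (hd : Polynomial.X ^ m ∣ Polynomial.X ^ w * c) : Polynomial.X ^ (m - w) ∣ c := by
  rw [show m = w + (m - w) by omega, pow_add] at hd
  simpa using (mul_dvd_mul_iff_left (pow_ne_zero w Polynomial.X_ne_zero)).1 hd

open Classical in
-- Two solutions differ by a multiple of `X^(m-w-e)`, since the cofactor of `X^e` in `a` is a unit
-- modulo powers of `X`. The top `e` coefficients thus determine a solution.
theorem card_searchFinset_filter_le {m w e : ℕ} (hw : w < m) (he : e ≤ m - w)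
    {a : (ZMod p)[X]} (H : (ZMod p)[X]) (hd : Polynomial.X ^ e ∣ a)
    (hnd : ¬ Polynomial.X ^ (e + 1) ∣ a) :
    ((searchFinset p m w).filter fun g =>
      Polynomial.X ^ m ∣ H + a * (Polynomial.X ^ w * g)).card ≤ p ^ e := by
  obtain ⟨b, rfl⟩ := hd
  have hb : ¬ Polynomial.X ∣ b := fun h => hnd (by rw [pow_succ]; exact mul_dvd_mul_left _ h)
  have hcard : p ^ e = Fintype.card (Fin e → ZMod p) := by simp [ZMod.card]
  rw [hcard, ← Finset.card_univ]
  refine Finset.card_le_card_of_injOn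
    (fun g (i : Fin e) => g.coeff (m - w - e + i)) (fun _ _ => Finset.mem_univ _) ?_
  intro g hg g' hg' heq
  simp only [Finset.coe_filter, Set.mem_ofPred_eq, mem_searchFinset, searchSet, if_pos hw] at hg hg'
  have h1 := dvd_sub hg.2 hg'.2
  rw [show H + Polynomial.X ^ e * b * (Polynomial.X ^ w * g)
      - (H + Polynomial.X ^ e * b * (Polynomial.X ^ w * g'))
      = Polynomial.X ^ w * (Polynomial.X ^ e * (b * (g - g'))) by ring] at h1
  have h2 := X_pow_dvd_of_dvd_mul_X_pow_mul he (X_pow_dvd_of_dvd_mul_X_pow_mul hw.le h1)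
  have h3 : Polynomial.X ^ (m - w - e) ∣ g - g' :=
    (isCoprime_X_pow_of_not_dvd hb _).dvd_of_dvd_mul_left h2
  rw [← sub_eq_zero]
  refine Polynomial.eq_zero_of_dvd_of_degree_lt h3 ?_
  rw [Polynomial.degree_X_pow, Polynomial.degree_lt_iff_coeff_zero]
  intro i hi
  rw [Polynomial.coeff_sub, sub_eq_zero]
  by_cases hi' : i < m - w
  · have := congrFun heq ⟨i - (m - w - e), by omega⟩
    simpa [show m - w - e + (i - (m - w - e)) = i by omega] using this
  · rw [(Polynomial.degree_lt_iff_coeff_zero _ _).1 hg.1.1 i (by omega),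
      (Polynomial.degree_lt_iff_coeff_zero _ _).1 hg'.1.1 i (by omega)]

open Classical in
/-- The average over the search set of the total kernel weight of the solutions `a` of
`H + a x^w g ≡ 0` modulo `x^m`. -/
theorem sum_rp_mul_card_le {m : ℕ} (w : ℕ) (H : (ZMod p)[X]) :
    ∑ a ∈ Finset.univ.filter (fun a : Polynomial.degreeLT (ZMod p) m =>
      a ≠ 0), rp p a *
        (((searchFinset p m w).filter fun g =>
          Polynomial.X ^ m ∣ H + (a : (ZMod p)[X]) * (Polynomial.X ^ w * g)).card : ℝ)
      ≤ (searchFinset p m w).card * (p * (m * sinSum p) * ((p : ℝ) ^ w / (p : ℝ) ^ m)) := by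
  have hp1 : (1 : ℝ) ≤ p := by exact_mod_cast (Fact.out : p.Prime).one_le
  have hp : (0 : ℝ) < p := zero_lt_one.trans_le hp1
  have hS : 0 ≤ m * sinSum p := mul_nonneg (Nat.cast_nonneg _) sinSum_nonneg
  set F := searchFinset p m w with hF
  set cnt : Polynomial.degreeLT (ZMod p) m → ℕ := fun a => (F.filter fun g =>
          Polynomial.X ^ m ∣ H + (a : (ZMod p)[X]) * (Polynomial.X ^ w * g)).card with hcnt
  have hFpos : (0 : ℝ) < F.card := by exact_mod_cast card_searchFinset_pos m w
  have hcntle : ∀ a, (cnt a : ℝ) ≤ F.card := fun a => by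
    exact_mod_cast Finset.card_filter_le _ _
  -- Divisibility of the contributing `a` by `X^e` saves a factor `p^e` in the kernel sum, to be
  -- balanced against the bound `B` on the number of solutions `g`.
  have hrestrict : ∀ (e : ℕ) (B : ℝ), 0 ≤ B →
      (∀ a, a ≠ 0 → cnt a ≠ 0 → Polynomial.X ^ e ∣ (a : (ZMod p)[X]) ∧ (cnt a : ℝ) ≤ B) →
      ∑ a ∈ Finset.univ.filter (fun a : Polynomial.degreeLT (ZMod p) m =>
      a ≠ 0), rp p a * (cnt a : ℝ)
        ≤ m * sinSum p / (p : ℝ) ^ e * B := by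
    intro e B hB hprop
    calc _ ≤ ∑ a ∈ Finset.univ.filter (fun a : Polynomial.degreeLT (ZMod p) m =>
      a ≠ 0 ∧ Polynomial.X ^ e ∣ (a : (ZMod p)[X])), rp p a * B := by
          rw [Finset.sum_filter, Finset.sum_filter]
          refine Finset.sum_le_sum fun a _ => ?_
          by_cases h0 : a ≠ 0
          · by_cases hc : cnt a = 0
            · rw [if_pos h0, hc, Nat.cast_zero, mul_zero]
              split_ifs
              · exact mul_nonneg (rp_nonneg _) hB
              · exact le_rfl
            · obtain ⟨h1, h2⟩ := hprop a h0 hc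
              rw [if_pos h0, if_pos ⟨h0, h1⟩]
              exact mul_le_mul_of_nonneg_left h2 (rp_nonneg _)
          · rw [if_neg h0, if_neg fun h => h0 h.1]
      _ ≤ _ := by
          rw [← Finset.sum_mul]
          exact mul_le_mul_of_nonneg_right (sum_rp_dvd_le m e) hB
  rcases le_or_gt m w with hw | hw
  · refine (hrestrict 0 F.card hFpos.le fun a _ _ => ⟨by simp, hcntle a⟩).trans ?_
    rw [pow_zero, div_one, mul_comm, mul_right_comm]
    refine mul_le_mul_of_nonneg_left ?_ hFpos.le
    have h1 : 1 ≤ (p : ℝ) ^ w / (p : ℝ) ^ m := by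
      rw [one_le_div (by positivity)]
      exact pow_le_pow_right₀ hp1 hw
    have h2 : 1 ≤ p * ((p : ℝ) ^ w / (p : ℝ) ^ m) := by nlinarith
    exact le_mul_of_one_le_left hS h2
  · have hratio : (p : ℝ) ^ w / (p : ℝ) ^ m = 1 / (p : ℝ) ^ (m - w) := by
      rw [pow_sub₀ _ hp.ne' hw.le]; field_simp
    by_cases hH : Polynomial.X ^ m ∣ H
    · refine (hrestrict (m - w) F.card hFpos.le fun a _ hc => ⟨?_, hcntle a⟩).trans ?_
      · obtain ⟨g, hg⟩ := Finset.card_ne_zero.1 hc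
        obtain ⟨hgF, hg⟩ := Finset.mem_filter.1 hg
        rw [dvd_add_right hH, mul_left_comm] at hg
        exact ((isCoprime_X_of_mem_searchFinset hw hgF).symm.pow_left).dvd_of_dvd_mul_right
          (X_pow_dvd_of_dvd_mul_X_pow_mul hw.le hg)
      · rw [hratio, mul_comm]
        refine mul_le_mul_of_nonneg_left ?_ hFpos.le
        rw [mul_one_div]
        refine div_le_div_of_nonneg_right ?_ (by positivity)
        exact le_mul_of_one_le_left hS hp1
    -- Otherwise all `a` admitting a solution have the same `X`-adic valuation `e < m - w`, fixed by
    -- `H`. The count `p^e` cancels the saving `p^(-e)`, and the size of the search set gives the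
    -- decay.
    · by_cases hall : ∀ a, a ≠ 0 → cnt a = 0
      · rw [Finset.sum_eq_zero fun a ha => by
          change rp p a * (cnt a : ℝ) = 0
          rw [hall a (Finset.mem_filter.1 ha).2, Nat.cast_zero, mul_zero]]
        positivity
      · push Not at hall
        obtain ⟨a₀, ha₀, hc₀⟩ := hall
        obtain ⟨g₀, hg₀⟩ := Finset.card_ne_zero.1 hc₀
        obtain ⟨hg₀F, hg₀⟩ := Finset.mem_filter.1 hg₀
        obtain ⟨e, b₀, hb₀, hab₀⟩ : ∃ e, ∃ b : (ZMod p)[X], ¬ Polynomial.X ∣ b ∧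
            (a₀ : (ZMod p)[X]) = Polynomial.X ^ e * b := by
          have hfin : FiniteMultiplicity (Polynomial.X : (ZMod p)[X]) (a₀ : (ZMod p)[X]) :=
            FiniteMultiplicity.of_prime_left Polynomial.prime_X fun h => ha₀ (Subtype.ext h)
          obtain ⟨b, hb, hnd⟩ := hfin.exists_eq_pow_mul_and_not_dvd
          exact ⟨_, b, hnd, hb⟩
        have he : e + 1 ≤ m - w := by
          by_contra hlt
          refine hH ((dvd_add_left ?_).1 hg₀)
          rw [hab₀, show Polynomial.X ^ e * b₀ * (Polynomial.X ^ w * g₀)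
            = Polynomial.X ^ (e + w) * (b₀ * g₀) by ring]
          exact (pow_dvd_pow _ (by omega)).mul_right _
        have hdvd : ∀ k ≤ m - w, ∀ a : Polynomial.degreeLT (ZMod p) m, cnt a ≠ 0 →
            (Polynomial.X ^ k ∣ (a : (ZMod p)[X]) ↔ Polynomial.X ^ k ∣ (a₀ : (ZMod p)[X])) := by
          intro k hk a hc
          obtain ⟨g, hg⟩ := Finset.card_ne_zero.1 hc
          obtain ⟨hgF, hg⟩ := Finset.mem_filter.1 hg
          have h1 := dvd_sub hg hg₀
          rw [show H + (a : (ZMod p)[X]) * (Polynomial.X ^ w * g)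
              - (H + (a₀ : (ZMod p)[X]) * (Polynomial.X ^ w * g₀))
              = Polynomial.X ^ w * ((a : (ZMod p)[X]) * g - (a₀ : (ZMod p)[X]) * g₀) by ring] at h1
          have h2 := (pow_dvd_pow _ hk).trans (X_pow_dvd_of_dvd_mul_X_pow_mul hw.le h1)
          have hcop : ∀ g ∈ F, ∀ c : (ZMod p)[X],
              Polynomial.X ^ k ∣ c * g ↔ Polynomial.X ^ k ∣ c := fun g hg c =>
            ⟨((isCoprime_X_of_mem_searchFinset hw hg).symm.pow_left).dvd_of_dvd_mul_right,
              fun h => h.mul_right g⟩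
          rw [← hcop g hgF (a : (ZMod p)[X]), ← hcop g₀ hg₀F (a₀ : (ZMod p)[X])]
          exact dvd_iff_dvd_of_dvd_sub h2
        have hd₀ : Polynomial.X ^ e ∣ (a₀ : (ZMod p)[X]) := ⟨b₀, hab₀⟩
        have hnd₀ : ¬ Polynomial.X ^ (e + 1) ∣ (a₀ : (ZMod p)[X]) := by
          rw [hab₀, pow_succ]
          exact fun h => hb₀ ((mul_dvd_mul_iff_left (pow_ne_zero e Polynomial.X_ne_zero)).1 h)
        refine (hrestrict e ((p : ℝ) ^ e) (by positivity) fun a _ hc => ?_).trans ?_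
        · have h1 := (hdvd e (by omega) a hc).2 hd₀
          refine ⟨h1, ?_⟩
          exact_mod_cast card_searchFinset_filter_le hw (by omega) H h1
            fun h => hnd₀ ((hdvd (e + 1) he a hc).1 h)
        · have hcard : (p : ℝ) ^ (m - w - 1) ≤ F.card := by
            exact_mod_cast le_card_searchFinset hw
          calc m * sinSum p / (p : ℝ) ^ e * (p : ℝ) ^ e
              = (p : ℝ) ^ (m - w - 1) * (p * (m * sinSum p) * (1 / (p : ℝ) ^ (m - w))) := by
                rw [show m - w = m - w - 1 + 1 by omega]
                simp only [Nat.add_sub_cancel, pow_succ]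
                field_simp
            _ ≤ _ := by
                rw [hratio]
                gcongr

end SearchSet

/-! ### Recursion for the dual sum in the last component -/

section DualSum

variable {p : ℕ} [Fact p.Prime]

open Classical in
/-- The sum defining `Rsum`, with the zero vector included. -/
noncomputable def dualSum (p : ℕ) [Fact p.Prime] (m : ℕ) (f : (ZMod p)[X]) (γ : ℕ → ℝ) {d : ℕ}
    (g : Fin d → (ZMod p)[X]) : ℝ :=
  ∑ h : Fin d → Polynomial.degreeLT (ZMod p) m with f ∣ ∑ i, (h i : (ZMod p)[X]) * g i,
    ∏ i, rpWeighted p (h i) (γ i)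

/-- The zero vector contributes a term independent of `g`. Including it makes the recursion uniform
in `h`. -/
theorem dualSum_eq (m : ℕ) (f : (ZMod p)[X]) (γ : ℕ → ℝ) {d : ℕ} (g : Fin d → (ZMod p)[X]) :
    dualSum p m f γ g = ∏ i : Fin d, (1 + γ i) + Rsum p m f γ g := by
  classical
  rw [dualSum, ← Finset.add_sum_erase _ _
    (show (0 : Fin d → Polynomial.degreeLT (ZMod p) m) ∈ _ by simp), Rsum]
  refine congrArg₂ (· + ·) ?_ ?_
  · simp [rpWeighted]
  · congr 1
    ext h
    simp

open Classical in
theorem sum_rpWeighted (m : ℕ) (c : ℝ) :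
    ∑ a : Polynomial.degreeLT (ZMod p) m, rpWeighted p a c
      = 1 + c + c * ∑ a : Polynomial.degreeLT (ZMod p) m with a ≠ 0, rp p a := by
  rw [← Finset.add_sum_erase _ _ (Finset.mem_univ (0 : Polynomial.degreeLT (ZMod p) m)),
    Finset.mul_sum]
  refine congrArg₂ (· + ·) ?_ ?_
  · simp [rpWeighted]
  · refine Finset.sum_congr (by ext; simp) fun a ha => ?_
    rw [rpWeighted, if_neg fun h0 : (a : (ZMod p)[X]) = 0 =>
        (Finset.mem_filter.1 ha).2 (Subtype.ext h0)]

open Classical in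
theorem dualSum_snoc (m : ℕ) (f : (ZMod p)[X]) (γ : ℕ → ℝ) {d : ℕ} (v : Fin d → (ZMod p)[X])
    (q : (ZMod p)[X]) :
    dualSum p m f γ (Fin.snoc v q : Fin (d + 1) → (ZMod p)[X])
      = (1 + γ d) * dualSum p m f γ v +
        γ d * ∑ h : Fin d → Polynomial.degreeLT (ZMod p) m, (∏ i, rpWeighted p (h i) (γ i)) *
          ∑ a : Polynomial.degreeLT (ZMod p) m with a ≠ 0, rp p a *
            if f ∣ ∑ i, (h i : (ZMod p)[X]) * v i + (a : (ZMod p)[X]) * q then 1 else 0 := by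
  have hstep : ∀ h : Fin d → Polynomial.degreeLT (ZMod p) m,
      ∑ a : Polynomial.degreeLT (ZMod p) m,
        (if f ∣ ∑ i, (h i : (ZMod p)[X]) * v i + (a : (ZMod p)[X]) * q then
          (∏ i, rpWeighted p (h i) (γ i)) * rpWeighted p a (γ d) else 0)
      = (1 + γ d) * (if f ∣ ∑ i, (h i : (ZMod p)[X]) * v i then
          ∏ i, rpWeighted p (h i) (γ i) else 0) +
        γ d * ((∏ i, rpWeighted p (h i) (γ i)) *
          ∑ a : Polynomial.degreeLT (ZMod p) m with a ≠ 0, rp p a *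
            if f ∣ ∑ i, (h i : (ZMod p)[X]) * v i + (a : (ZMod p)[X]) * q then 1 else 0) := by
    intro h
    rw [← Finset.add_sum_erase _ _ (Finset.mem_univ (0 : Polynomial.degreeLT (ZMod p) m)),
      Finset.mul_sum, Finset.mul_sum]
    congr 1
    · simp [rpWeighted, mul_comm]
    · refine Finset.sum_congr (by ext; simp) fun a ha => ?_
      rw [rpWeighted, if_neg fun h0 : (a : (ZMod p)[X]) = 0 =>
        (Finset.mem_filter.1 ha).2 (Subtype.ext h0)]
      split_ifs <;> ring
  rw [dualSum, Finset.sum_filter, ← (Fin.snocEquiv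
    (fun _ : Fin (d + 1) => Polynomial.degreeLT (ZMod p) m)).sum_comp, Fintype.sum_prod_type_right,
    dualSum, Finset.sum_filter, Finset.mul_sum, Finset.mul_sum, ← Finset.sum_add_distrib]
  refine Finset.sum_congr rfl fun h _ => ?_
  rw [← hstep h]
  refine Finset.sum_congr rfl fun a _ => ?_
  simp only [Fin.snocEquiv, Equiv.coe_fn_mk, Fin.sum_univ_castSucc, Fin.prod_univ_castSucc,
    Fin.snoc_castSucc, Fin.snoc_last, Fin.val_castSucc, Fin.val_last]

/-- A quantity that is at most `Rsum` for all choices of the last component from the search set is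
bounded by the average over this set. -/
theorem le_of_forall_le_Rsum_snoc {m : ℕ} (w : ℕ) {γ : ℕ → ℝ} (hγ : ∀ j, 0 ≤ γ j) {d : ℕ}
    (v : Fin d → (ZMod p)[X]) {r : ℝ}
    (hr : ∀ q ∈ searchSet p m w (Polynomial.X ^ m), r ≤ Rsum p m (Polynomial.X ^ m) γ
      (Fin.snoc v (Polynomial.X ^ w * q) : Fin (d + 1) → (ZMod p)[X])) :
    r ≤ (1 + γ d) * Rsum p m (Polynomial.X ^ m) γ v
      + γ d * (p * (m * sinSum p) * ((p : ℝ) ^ w / (p : ℝ) ^ m)) *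
        ∏ i : Fin d, (1 + γ i + γ i * (m * sinSum p)) := by
  classical
  set F := searchFinset p m w with hF
  set B := p * (m * sinSum p) * ((p : ℝ) ^ w / (p : ℝ) ^ m) with hB
  have hFpos : (0 : ℝ) < F.card := by exact_mod_cast card_searchFinset_pos m w
  have hB0 : 0 ≤ B := by
    have := sinSum_nonneg (p := p)
    positivity
  -- The zero-vector products cancel, so the recursion for `dualSum` passes to `Rsum`.
  have hR : ∀ q : (ZMod p)[X], Rsum p m (Polynomial.X ^ m) γ
      (Fin.snoc v (Polynomial.X ^ w * q) : Fin (d + 1) → (ZMod p)[X])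
      = (1 + γ d) * Rsum p m (Polynomial.X ^ m) γ v +
        γ d * ∑ h : Fin d → Polynomial.degreeLT (ZMod p) m, (∏ i, rpWeighted p (h i) (γ i)) *
          ∑ a : Polynomial.degreeLT (ZMod p) m with a ≠ 0, rp p a *
            if Polynomial.X ^ m ∣ ∑ i, (h i : (ZMod p)[X]) * v i +
              (a : (ZMod p)[X]) * (Polynomial.X ^ w * q) then 1 else 0 := by
    intro q
    have h1 := dualSum_snoc m (Polynomial.X ^ m) γ v (Polynomial.X ^ w * q)
    rw [dualSum_eq, dualSum_eq, Fin.prod_univ_castSucc] at h1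
    simp only [Fin.val_castSucc, Fin.val_last] at h1
    linarith
  -- The bound for the averaged inner sum is uniform in `h`, so the outer sum runs over all `h` and
  -- factors.
  have hA : ∑ h : Fin d → Polynomial.degreeLT (ZMod p) m, ∏ i, rpWeighted p (h i) (γ i)
      ≤ ∏ i : Fin d, (1 + γ i + γ i * (m * sinSum p)) := by
    rw [← Fintype.prod_sum fun (i : Fin d) (a : Polynomial.degreeLT (ZMod p) m) =>
      rpWeighted p a (γ i)]
    refine Finset.prod_le_prod (fun i _ => Finset.sum_nonneg fun a _ =>
      rpWeighted_nonneg _ (hγ i)) fun i _ => ?_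
    rw [sum_rpWeighted]
    have := mul_le_mul_of_nonneg_left (sum_rp_le (p := p) m) (hγ i)
    linarith
  have hsum : F.card * r ≤ F.card * ((1 + γ d) * Rsum p m (Polynomial.X ^ m) γ v) +
      γ d * ∑ h : Fin d → Polynomial.degreeLT (ZMod p) m, (∏ i, rpWeighted p (h i) (γ i)) *
        (F.card * B) := by
    calc F.card * r = ∑ _q ∈ F, r := by rw [Finset.sum_const, nsmul_eq_mul]
      _ ≤ ∑ q ∈ F, Rsum p m (Polynomial.X ^ m) γ
          (Fin.snoc v (Polynomial.X ^ w * q) : Fin (d + 1) → (ZMod p)[X]) :=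
        Finset.sum_le_sum fun q hq => hr q (mem_searchFinset.1 hq)
      _ = F.card * ((1 + γ d) * Rsum p m (Polynomial.X ^ m) γ v) +
          γ d * ∑ h : Fin d → Polynomial.degreeLT (ZMod p) m,
            (∏ i, rpWeighted p (h i) (γ i)) *
            ∑ a : Polynomial.degreeLT (ZMod p) m with a ≠ 0, rp p a *
              ((F.filter fun q => Polynomial.X ^ m ∣ ∑ i, (h i : (ZMod p)[X]) * v i +
                (a : (ZMod p)[X]) * (Polynomial.X ^ w * q)).card : ℝ) := by
        simp only [hR]
        rw [Finset.sum_add_distrib, Finset.sum_const, nsmul_eq_mul, ← Finset.mul_sum,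
          Finset.sum_comm]
        congr 2
        refine Finset.sum_congr rfl fun h _ => ?_
        rw [← Finset.mul_sum, Finset.sum_comm]
        congr 1
        refine Finset.sum_congr rfl fun a _ => ?_
        rw [← Finset.mul_sum, Finset.sum_boole]
      _ ≤ _ := by
        gcongr with h _
        · exact hγ d
        · exact Finset.prod_nonneg fun i _ => rpWeighted_nonneg _ (hγ i)
        · exact sum_rp_mul_card_le w _
  rw [← Finset.sum_mul] at hsum
  refine le_of_mul_le_mul_left (hsum.trans ?_) hFpos
  rw [mul_add]
  refine add_le_add le_rfl ?_
  calc γ d * ((∑ h : Fin d → Polynomial.degreeLT (ZMod p) m, ∏ i, rpWeighted p (h i) (γ i)) *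
        (F.card * B)) ≤ γ d * ((∏ i : Fin d, (1 + γ i + γ i * (m * sinSum p))) *
        (F.card * B)) := by
        gcongr
        exact hγ d
    _ = _ := by ring

end DualSum

/-! ### The component-by-component bound and existence of outputs -/

section Construction

variable {p : ℕ} [Fact p.Prime]

theorem initial_genVector_update (w : ℕ → ℕ) {s : ℕ} (g : Fin s → (ZMod p)[X]) (d : Fin s)
    (q : (ZMod p)[X]) :
    initial (genVector w (Function.update g d q)) d
      = Fin.snoc (fun i : Fin d.1 => genVector w g (Fin.castLE d.isLt.le i))
          (Polynomial.X ^ w d * q) := by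
  funext i
  induction i using Fin.lastCases with
  | last =>
    have : Fin.castLE d.isLt (Fin.last d.1) = d := Fin.ext rfl
    rw [Fin.snoc_last, initial, this, genVector, Function.update_self]
  | cast i =>
    have hne : Fin.castLE d.isLt i.castSucc ≠ d := fun h => by
      have := congrArg Fin.val h
      simp only [Fin.val_castLE, Fin.val_castSucc] at this
      omega
    rw [Fin.snoc_castSucc, initial, genVector, Function.update_of_ne hne]
    rfl

theorem IsReducedCBC.Rsum_le {m : ℕ} {γ : ℕ → ℝ} (hγ : ∀ j, 0 ≤ γ j) {w : ℕ → ℕ}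
    (hw : w 0 = 0) {s : ℕ} {g : Fin s → (ZMod p)[X]}
    (hg : IsReducedCBC p m (Polynomial.X ^ m) γ w g) (n : ℕ) (hn : n ≤ s) :
    Rsum p m (Polynomial.X ^ m) γ (fun i : Fin n => genVector w g (Fin.castLE hn i))
      ≤ (∏ i ∈ Finset.range n, (1 + γ i + γ i * (p : ℝ) ^ w i * (p * (m * sinSum p))))
        / (p : ℝ) ^ m := by
  classical
  have hp1 : (1 : ℝ) ≤ p := by exact_mod_cast (Fact.out : p.Prime).one_le
  have hp : (0 : ℝ) < p := zero_lt_one.trans_le hp1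
  have hS : 0 ≤ m * sinSum p := mul_nonneg (Nat.cast_nonneg _) sinSum_nonneg
  have hfac : ∀ i, 0 ≤ 1 + γ i + γ i * (p : ℝ) ^ w i * (p * (m * sinSum p)) := fun i => by
    have := hγ i
    positivity
  have hrhs : ∀ n, 0 ≤ (∏ i ∈ Finset.range n,
      (1 + γ i + γ i * (p : ℝ) ^ w i * (p * (m * sinSum p)))) / (p : ℝ) ^ m := fun n =>
    div_nonneg (Finset.prod_nonneg fun i _ => hfac i) (by positivity)
  induction n with
  | zero =>
    rw [Rsum, Finset.sum_eq_zero]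
    · exact hrhs 0
    · intro h hh
      exact absurd (Subsingleton.elim h 0) (Finset.mem_filter.1 hh).2.1
  | succ n ih =>
    -- The first component is not a minimiser, but it is `1` with `w 0 = 0`: the dual condition
    -- becomes `x^m ∣ h` with `h` of degree less than `m`, so the sum is empty.
    obtain rfl | hn0 := Nat.eq_zero_or_pos n
    · rw [Rsum, Finset.sum_eq_zero]
      · exact hrhs 1
      · intro h hh
        obtain ⟨-, hne, hd⟩ := Finset.mem_filter.1 hh
        refine absurd ?_ hne
        have hval : (Fin.castLE hn (0 : Fin (0 + 1))).1 = 0 := rfl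
        rw [Fin.sum_univ_one, genVector, hg.first _ hval, hval, hw, pow_zero, one_mul, mul_one]
          at hd
        have h0 : (h 0 : (ZMod p)[X]) = 0 := Polynomial.eq_zero_of_dvd_of_degree_lt hd (by
          rw [Polynomial.degree_X_pow]
          exact Polynomial.mem_degreeLT.1 (h 0).2)
        funext i
        rw [Fin.fin_one_eq_zero i]
        exact Subtype.ext h0
    · set d : Fin s := ⟨n, hn⟩ with hd
      have hrec := le_of_forall_le_Rsum_snoc (m := m) (w d) hγ
        (fun i : Fin n => genVector w g (Fin.castLE (Nat.le_of_succ_le hn) i))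
        (r := Rsum p m (Polynomial.X ^ m) γ
          (fun i : Fin (n + 1) => genVector w g (Fin.castLE hn i))) fun q hq => by
          have h1 := hg.minimal d hn0 q hq
          rw [initial_genVector_update] at h1
          exact h1
      refine hrec.trans ?_
      have ih' := ih (Nat.le_of_succ_le hn)
      -- Enlarging these factors to those of the induction hypothesis lets the product be pulled out
      -- of both terms.
      have hA : ∏ i : Fin n, (1 + γ i + γ i * (m * sinSum p)) ≤ ∏ i ∈ Finset.range n,
          (1 + γ i + γ i * (p : ℝ) ^ w i * (p * (m * sinSum p))) := by
        rw [← Fin.prod_univ_eq_prod_range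
          (fun i => 1 + γ i + γ i * (p : ℝ) ^ w i * (p * (m * sinSum p)))]
        refine Finset.prod_le_prod (fun i _ => ?_) fun i _ => ?_
        · have := hγ i
          positivity
        · have h1 : 1 ≤ (p : ℝ) ^ w i * p :=
            one_le_mul_of_one_le_of_one_le (one_le_pow₀ hp1) hp1
          have h2 := le_mul_of_one_le_left (mul_nonneg (hγ i) hS) h1
          linarith
      have hγn := hγ n
      rw [Finset.prod_range_succ]
      set P := ∏ i ∈ Finset.range n, (1 + γ i + γ i * (p : ℝ) ^ w i * (p * (m * sinSum p)))
      change (1 + γ n) * _ + γ n * (p * (m * sinSum p) * ((p : ℝ) ^ w n / (p : ℝ) ^ m)) * _ ≤ _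
      calc _ ≤ (1 + γ n) * (P / (p : ℝ) ^ m) +
            γ n * (p * (m * sinSum p) * ((p : ℝ) ^ w n / (p : ℝ) ^ m)) * P := by
            gcongr
        _ = _ := by ring

theorem initial_genVector_snoc_castSucc (w : ℕ → ℕ) {s : ℕ} (g : Fin s → (ZMod p)[X])
    (q : (ZMod p)[X]) (d : Fin s) :
    initial (genVector w (Fin.snoc g q : Fin (s + 1) → (ZMod p)[X])) d.castSucc
      = initial (genVector w g) d := by
  funext i
  have : Fin.castLE d.castSucc.isLt i = (Fin.castLE d.isLt i).castSucc := Fin.ext rfl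
  rw [initial, this, genVector, Fin.snoc_castSucc]
  rfl

/-- An output is extended by a minimiser over a finite nonempty set; earlier minimality conditions
do not involve the new component. -/
theorem exists_isReducedCBC (m : ℕ) (γ : ℕ → ℝ) (w : ℕ → ℕ) (s : ℕ) :
    ∃ g : Fin s → (ZMod p)[X], IsReducedCBC p m (Polynomial.X ^ m) γ w g := by
  induction s with
  | zero => exact ⟨fun i => i.elim0, fun d => d.elim0, fun d => d.elim0, fun d => d.elim0⟩
  | succ s ih =>
    obtain ⟨g, hg⟩ := ih
    obtain ⟨q, hq, hq0, hmin⟩ : ∃ q ∈ searchSet p m (w s) (Polynomial.X ^ m), (s = 0 → q = 1) ∧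
        (1 ≤ s → ∀ q' ∈ searchSet p m (w s) (Polynomial.X ^ m),
          Rsum p m (Polynomial.X ^ m) γ
            (Fin.snoc (genVector w g) (Polynomial.X ^ w s * q) : Fin (s + 1) → (ZMod p)[X]) ≤
          Rsum p m (Polynomial.X ^ m) γ
            (Fin.snoc (genVector w g) (Polynomial.X ^ w s * q') : Fin (s + 1) → (ZMod p)[X])) := by
      obtain rfl | hs := Nat.eq_zero_or_pos s
      · exact ⟨1, one_mem_searchSet _ _ _, fun _ => rfl, fun h => by omega⟩
      · obtain ⟨q, hq, hmin⟩ := Finset.exists_min_image (searchFinset p m (w s))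
          (fun q => Rsum p m (Polynomial.X ^ m) γ
            (Fin.snoc (genVector w g) (Polynomial.X ^ w s * q) : Fin (s + 1) → (ZMod p)[X]))
          (Finset.card_pos.1 (card_searchFinset_pos m (w s)))
        exact ⟨q, mem_searchFinset.1 hq, fun h => by omega,
          fun _ q' hq' => hmin q' (mem_searchFinset.2 hq')⟩
    have hlast : ∀ q' : (ZMod p)[X],
        initial (genVector w (Function.update (Fin.snoc g q : Fin (s + 1) → (ZMod p)[X])
          (Fin.last s) q')) (Fin.last s) = Fin.snoc (genVector w g) (Polynomial.X ^ w s * q') := by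
      intro q'
      rw [initial_genVector_update]
      congr 1
      funext i
      have : Fin.castLE (Fin.last s).isLt.le i = i.castSucc := Fin.ext rfl
      rw [this, genVector, Fin.snoc_castSucc]
      rfl
    refine ⟨Fin.snoc g q, fun d => ?_, fun d hd => ?_, fun d hd q' hq' => ?_⟩
    · induction d using Fin.lastCases with
      | last => rw [Fin.snoc_last]; exact hq
      | cast d => rw [Fin.snoc_castSucc]; exact hg.mem d
    · induction d using Fin.lastCases with
      | last => rw [Fin.snoc_last]; exact hq0 hd
      | cast d => rw [Fin.snoc_castSucc]; exact hg.first d hd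
    · induction d using Fin.lastCases with
      | last =>
        have h1 := hlast q
        rw [Function.update_eq_self_iff.2 (by rw [Fin.snoc_last])] at h1
        rw [h1, hlast q']
        exact hmin hd q' hq'
      | cast d =>
        rw [← Fin.snoc_update, initial_genVector_snoc_castSucc, initial_genVector_snoc_castSucc]
        exact hg.minimal d hd q' hq'

end Construction

/-! ### Uniform growth of products -/

section Growth

/-- A product `∏ (1 + m a_i)` with summable `a` grows subexponentially in `m`, uniformly in the
number of factors. -/
theorem exists_prod_one_add_mul_le {a : ℕ → ℝ} (ha : ∀ i, 0 ≤ a i) (hs : Summable a) {η : ℝ}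
    (hη : 0 < η) :
    ∃ C > (0 : ℝ), ∀ m s : ℕ, ∏ i ∈ Finset.range s, (1 + m * a i) ≤ C * Real.exp (m * η) := by
  classical
  -- Outside `T` the factors are at most `exp (m a_i)`, with total exponent at most `m η / 2`.
  -- Inside `T`, `1 + m a_i ≤ (1 + a_i / c) exp (m c)`, and `c` is chosen so that `T.card * c ≤ η /
  -- 2`.
  obtain ⟨T, hT⟩ := summable_iff_vanishing_norm.1 hs (η / 2) (by positivity)
  set c : ℝ := η / (2 * (T.card + 1)) with hc
  have hc0 : 0 < c := by positivity
  have hTc : T.card * c ≤ η / 2 := by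
    rw [hc, mul_div_assoc', div_le_div_iff₀ (by positivity) (by positivity)]
    nlinarith
  refine ⟨Real.exp (∑ i ∈ T, Real.log (1 + a i / c)), Real.exp_pos _, fun m s => ?_⟩
  have hlog : ∀ i, 0 ≤ Real.log (1 + a i / c) := fun i =>
    Real.log_nonneg (le_add_of_nonneg_right (div_nonneg (ha i) hc0.le))
  have hfac : ∀ i, 1 + m * a i ≤
      Real.exp (if i ∈ T then Real.log (1 + a i / c) + m * c else m * a i) := by
    intro i
    have hai := ha i
    split_ifs with hi
    · rw [Real.exp_add, Real.exp_log (by positivity)]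
      have h1 : (m : ℝ) * c + 1 ≤ Real.exp (m * c) := Real.add_one_le_exp _
      calc 1 + m * a i ≤ (1 + a i / c) * (m * c + 1) := by
            have h2 : a i / c * (m * c) = m * a i := by field_simp
            have h3 : 0 ≤ a i / c := by positivity
            have h4 : 0 ≤ m * c := by positivity
            nlinarith
        _ ≤ _ := by gcongr
    · linarith [Real.add_one_le_exp (m * a i)]
  calc ∏ i ∈ Finset.range s, (1 + m * a i)
      ≤ ∏ i ∈ Finset.range s,
          Real.exp (if i ∈ T then Real.log (1 + a i / c) + m * c else m * a i) :=
        Finset.prod_le_prod (fun i _ => by have := ha i; positivity) fun i _ => hfac i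
    _ = Real.exp (∑ i ∈ (Finset.range s).filter (· ∈ T), (Real.log (1 + a i / c) + m * c) +
          m * ∑ i ∈ (Finset.range s).filter (· ∉ T), a i) := by
        rw [← Real.exp_sum, Finset.sum_ite, Finset.mul_sum]
    _ ≤ Real.exp (∑ i ∈ T, (Real.log (1 + a i / c) + m * c) + m * (η / 2)) := by
        refine Real.exp_le_exp.2 (add_le_add ?_ (mul_le_mul_of_nonneg_left ?_ (by positivity)))
        · refine Finset.sum_le_sum_of_subset_of_nonneg
            (fun i hi => (Finset.mem_filter.1 hi).2) fun i _ _ => ?_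
          have := hlog i
          positivity
        · refine (le_abs_self _).trans (hT _ ?_).le
          rw [Finset.disjoint_left]
          exact fun i hi => (Finset.mem_filter.1 hi).2
    _ ≤ _ := by
        rw [← Real.exp_add, Finset.sum_add_distrib, Finset.sum_const, nsmul_eq_mul]
        refine Real.exp_le_exp.2 ?_
        have : (m : ℝ) * (T.card * c) ≤ m * (η / 2) :=
          mul_le_mul_of_nonneg_left hTc (Nat.cast_nonneg m)
        nlinarith

/-- Uses `|u| ≤ 2^|u|` and `2 γ_j ≤ exp (2 γ_j)`. -/
theorem prod_mul_card_le_exp {γ : ℕ → ℝ} (hγ : ∀ j, 0 ≤ γ j) (hs : Summable γ) {s : ℕ}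
    (u : Finset (Fin s)) : (∏ j ∈ u, γ j) * u.card ≤ Real.exp (2 * ∑' j, γ j) := by
  have h1 : (u.card : ℝ) ≤ 2 ^ u.card := by exact_mod_cast Nat.lt_two_pow_self.le
  calc (∏ j ∈ u, γ j) * u.card ≤ (∏ j ∈ u, γ j) * 2 ^ u.card :=
        mul_le_mul_of_nonneg_left h1 (Finset.prod_nonneg fun j _ => hγ j)
    _ = ∏ j ∈ u, (γ j * 2) := by rw [Finset.prod_mul_distrib, Finset.prod_const]
    _ ≤ ∏ j ∈ u, Real.exp (γ j * 2) := Finset.prod_le_prod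
        (fun j _ => mul_nonneg (hγ j) zero_le_two)
        fun j _ => by linarith [Real.add_one_le_exp (γ j * 2)]
    _ = Real.exp (2 * ∑ j ∈ u, γ j) := by rw [← Real.exp_sum, ← Finset.sum_mul, mul_comm]
    _ ≤ _ := by
        gcongr
        calc ∑ j ∈ u, γ j ≤ ∑ j : Fin s, γ j :=
              Finset.sum_le_sum_of_subset_of_nonneg (Finset.subset_univ _) fun j _ _ => hγ j
          _ = ∑ j ∈ Finset.range s, γ j := Fin.sum_univ_eq_sum_range γ s
          _ ≤ _ := hs.sum_le_tsum _ fun j _ => hγ j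

end Growth

theorem weightedStarDisc_nonneg {γ : ℕ → ℝ} (hγ : ∀ j, 0 ≤ γ j) {N s : ℕ}
    (P : Fin N → Fin s → ℝ) : 0 ≤ weightedStarDisc γ P :=
  Real.iSup_nonneg fun _ => Real.iSup_nonneg fun _ =>
    mul_nonneg (Finset.prod_nonneg fun j _ => hγ j) (abs_nonneg _)

theorem minDisc_le {γ : ℕ → ℝ} (hγ : ∀ j, 0 ≤ γ j) {N s : ℕ} (P : Fin N → Fin s → ℝ)
    (hP : ∀ n j, P n j ∈ Set.Ico (0 : ℝ) 1) : minDisc γ N s ≤ weightedStarDisc γ P :=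
  ciInf_le (f := fun P : Fin N → Fin s → Set.Ico (0 : ℝ) 1 =>
      weightedStarDisc γ fun n j => (P n j : ℝ))
    ⟨0, by rintro _ ⟨P, rfl⟩; exact weightedStarDisc_nonneg hγ _⟩ fun n j => ⟨P n j, hP n j⟩

/-! ### Convergence rate and tractability -/

section Rate

variable {p : ℕ} [Fact p.Prime] {γ : ℕ → ℝ} {w : ℕ → ℕ}

theorem IsReducedCBC.exists_weightedStarDisc_le (hγ : ∀ j, 0 ≤ γ j) (hw : w 0 = 0)
    (hsum : Summable fun j => γ j * (p : ℝ) ^ w j) {δ : ℝ} (hδ : 0 < δ) :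
    ∃ C > (0 : ℝ), ∀ m s : ℕ, 1 ≤ m → ∀ g : Fin s → (ZMod p)[X],
      IsReducedCBC p m (Polynomial.X ^ m) γ w g →
      weightedStarDisc γ (polyLatticePoints p m (Polynomial.X ^ m) (genVector w g))
        ≤ C * ((p : ℝ) ^ m) ^ (-1 + δ) := by
  have hp1 : (1 : ℝ) < p := by exact_mod_cast (Fact.out : p.Prime).one_lt
  have hp : (0 : ℝ) < p := zero_lt_one.trans hp1
  have hle : ∀ j, γ j ≤ γ j * (p : ℝ) ^ w j := fun j =>
    le_mul_of_one_le_right (hγ j) (one_le_pow₀ hp1.le)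
  have hγs : Summable γ := Summable.of_nonneg_of_le hγ hle hsum
  have hS := sinSum_nonneg (p := p)
  -- The summand `1` in `1 + p * sinSum p` absorbs the bare `γ i`, as `m ≥ 1`. The exponent `δ log
  -- p` makes `exp (m η)` equal to `N^δ`.
  obtain ⟨C, hC, hprod⟩ := exists_prod_one_add_mul_le
    (a := fun j => γ j * (p : ℝ) ^ w j * (1 + p * sinSum p))
    (fun j => by have := hγ j; positivity) (hsum.mul_right _)
    (mul_pos hδ (Real.log_pos hp1))
  refine ⟨C + Real.exp (2 * ∑' j, γ j), by positivity, fun m s hm g hg => ?_⟩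
  have hN : (0 : ℝ) < (p : ℝ) ^ m := by positivity
  have hexp : Real.exp (m * (δ * Real.log p)) = ((p : ℝ) ^ m) ^ δ := by
    rw [Real.rpow_def_of_pos hN, Real.log_pow]
    ring_nf
  have hone : 1 ≤ ((p : ℝ) ^ m) ^ δ := Real.one_le_rpow (one_le_pow₀ hp1.le) hδ.le
  have hR : Rsum p m (Polynomial.X ^ m) γ (genVector w g) ≤
      C * ((p : ℝ) ^ m) ^ δ / (p : ℝ) ^ m := by
    refine (hg.Rsum_le hγ hw s le_rfl).trans ?_
    rw [← hexp]
    refine div_le_div_of_nonneg_right (le_trans ?_ (hprod m s)) hN.le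
    refine Finset.prod_le_prod (fun i _ => by have := hγ i; positivity) fun i _ => ?_
    have hm' : (1 : ℝ) ≤ m := by exact_mod_cast hm
    have h1 : γ i ≤ m * (γ i * (p : ℝ) ^ w i) :=
      (hle i).trans (le_mul_of_one_le_left (by have := hγ i; positivity) hm')
    linarith
  refine (weightedStarDisc_le hm hγ (genVector w g)
    (prod_mul_card_le_exp hγ hγs)).trans ?_
  rw [Real.rpow_add hN, Real.rpow_neg_one]
  calc _ ≤ C * ((p : ℝ) ^ m) ^ δ / (p : ℝ) ^ m +
        Real.exp (2 * ∑' j, γ j) * ((p : ℝ) ^ m) ^ δ / (p : ℝ) ^ m := by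
        gcongr
        exact le_mul_of_one_le_right (Real.exp_pos _).le hone
    _ = _ := by ring

theorem IsReducedCBC.exists_pow_le_and_weightedStarDisc_le (hγ : ∀ j, 0 ≤ γ j) (hw : w 0 = 0)
    (hsum : Summable fun j => γ j * (p : ℝ) ^ w j) :
    ∃ C > (0 : ℝ), ∃ τ > (0 : ℝ), ∀ s : ℕ, 1 ≤ s → ∀ ε ∈ Set.Ioo (0 : ℝ) 1,
      ∃ m : ℕ, 1 ≤ m ∧ (p : ℝ) ^ m ≤ C * ε ^ (-τ) ∧ ∀ g : Fin s → (ZMod p)[X],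
        IsReducedCBC p m (Polynomial.X ^ m) γ w g →
        weightedStarDisc γ (polyLatticePoints p m (Polynomial.X ^ m) (genVector w g)) ≤ ε := by
  have hp1 : (1 : ℝ) < p := by exact_mod_cast (Fact.out : p.Prime).one_lt
  have hp : (0 : ℝ) < p := zero_lt_one.trans hp1
  obtain ⟨C, hC, hrate⟩ := IsReducedCBC.exists_weightedStarDisc_le hγ hw hsum
    (show (0 : ℝ) < 1 / 2 by norm_num)
  -- With rate `C N^(-1/2)` one needs `N ≥ C^2 / ε^2`. Passing to the next power of `p` costs the
  -- factor `p`, and the maximum with `1` ensures a target of at least `1`.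
  refine ⟨p * max 1 (C ^ 2), by positivity, 2, two_pos, fun s _ ε hε => ?_⟩
  obtain ⟨hε0, hε1⟩ := hε
  have hpow : ε ^ (-2 : ℝ) = (ε ^ 2)⁻¹ := by
    rw [Real.rpow_neg hε0.le, Real.rpow_two]
  have hy : 1 ≤ max 1 (C ^ 2) * (ε ^ 2)⁻¹ :=
    one_le_mul_of_one_le_of_one_le (le_max_left _ _)
      ((one_le_inv₀ (by positivity)).2 (pow_le_one₀ hε0.le hε1.le))
  obtain ⟨n, hn1, hn2⟩ := exists_nat_pow_near hy hp1
  refine ⟨n + 1, by omega, ?_, fun g hg => (hrate (n + 1) s (by omega) g hg).trans ?_⟩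
  · rw [hpow, pow_succ', mul_assoc]
    gcongr
  · have hN : (0 : ℝ) < (p : ℝ) ^ (n + 1) := by positivity
    have hsq : C / ε ≤ √((p : ℝ) ^ (n + 1)) := by
      rw [Real.le_sqrt' (by positivity), div_pow, div_eq_mul_inv]
      refine le_trans ?_ hn2.le
      gcongr
      exact le_max_right _ _
    rw [show (-1 + 1 / 2 : ℝ) = -(1 / 2) by norm_num, Real.rpow_neg hN.le, ← Real.sqrt_eq_rpow,
      ← div_eq_mul_inv, div_le_iff₀ (Real.sqrt_pos.2 hN), mul_comm]
    exact (div_le_iff₀ hε0).1 hsq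

theorem stronglyPolynomiallyTractable_of_summable (hγ : ∀ j, 0 ≤ γ j) (hw : w 0 = 0)
    (hsum : Summable fun j => γ j * (p : ℝ) ^ w j) : StronglyPolynomiallyTractable γ := by
  obtain ⟨C, hC, τ, hτ, h⟩ := IsReducedCBC.exists_pow_le_and_weightedStarDisc_le hγ hw hsum
  refine ⟨C, hC, τ, hτ, fun s hs ε hε => ?_⟩
  obtain ⟨m, -, hpm, hg⟩ := h s hs ε hε
  obtain ⟨g, hcbc⟩ := exists_isReducedCBC (p := p) m γ w s
  have hmin : minDisc γ (p ^ m) s ≤ ε :=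
    (minDisc_le hγ _ (polyLatticePoints_mem_Ico m (genVector w g))).trans (hg g hcbc)
  have h1 : infoComplexity γ s ε ≤ ((p ^ m : ℕ) : ℕ∞) :=
    iInf_le (fun N : {N : ℕ // 1 ≤ N ∧ minDisc γ N s ≤ ε} => (N.1 : ℕ∞))
      ⟨p ^ m, Nat.one_le_pow _ _ (Fact.out : p.Prime).pos, hmin⟩
  calc (infoComplexity γ s ε : ℝ≥0∞) ≤ (((p ^ m : ℕ) : ℕ∞) : ℝ≥0∞) := ENat.toENNReal_le.2 h1
    _ = ENNReal.ofReal ((p : ℝ) ^ m) := by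
        rw [ENat.toENNReal_coe, ← ENNReal.ofReal_natCast]
        push_cast
        rfl
    _ ≤ _ := ENNReal.ofReal_le_ofReal hpm

end Rate

end PolyLattice

theorem mainTheorem4 (p : ℕ) [Fact p.Prime]
    (γ : ℕ → ℝ) (hγ_pos : ∀ j, 0 < γ j) (hγ_le : ∀ j, γ j ≤ 1) (hγ_anti : Antitone γ)
    (w : ℕ → ℕ) (hw_zero : w 0 = 0) (hw_mono : Monotone w)
    (hsum : Summable fun j => γ j * (p : ℝ) ^ w j) :
    -- the algorithm always has an output
    (∀ m s : ℕ, 1 ≤ m → 1 ≤ s → ∃ g : Fin s → Polynomial (ZMod p),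
      PolyLattice.IsReducedCBC p m (Polynomial.X ^ m) γ w g) ∧
    -- strong polynomial tractability
    PolyLattice.StronglyPolynomiallyTractable γ ∧
    -- it is achieved by the point sets that the algorithm constructs
    (∃ C > (0 : ℝ), ∃ τ > (0 : ℝ), ∀ s : ℕ, 1 ≤ s → ∀ ε ∈ Set.Ioo (0 : ℝ) 1,
      ∃ m : ℕ, 1 ≤ m ∧ (p : ℝ) ^ m ≤ C * ε ^ (-τ) ∧
        ∀ g : Fin s → Polynomial (ZMod p),
          PolyLattice.IsReducedCBC p m (Polynomial.X ^ m) γ w g →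
          PolyLattice.weightedStarDisc γ
            (PolyLattice.polyLatticePoints p m (Polynomial.X ^ m)
              (PolyLattice.genVector w g)) ≤ ε) ∧
    -- the rate, with a constant that depends neither on `s` nor on `m`
    (∀ δ > (0 : ℝ), ∃ C > (0 : ℝ), ∀ m s : ℕ, 1 ≤ m → 1 ≤ s →
      ∀ g : Fin s → Polynomial (ZMod p),
        PolyLattice.IsReducedCBC p m (Polynomial.X ^ m) γ w g →
        PolyLattice.weightedStarDisc γ
          (PolyLattice.polyLatticePoints p m (Polynomial.X ^ m)
            (PolyLattice.genVector w g)) ≤ C * ((p : ℝ) ^ m) ^ (-1 + δ)) := by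
  have hγ : ∀ j, 0 ≤ γ j := fun j => (hγ_pos j).le
  refine ⟨fun m s _ _ => PolyLattice.exists_isReducedCBC m γ w s,
    PolyLattice.stronglyPolynomiallyTractable_of_summable hγ hw_zero hsum,
    PolyLattice.IsReducedCBC.exists_pow_le_and_weightedStarDisc_le hγ hw_zero hsum,
    fun δ hδ => ?_⟩
  obtain ⟨C, hC, h⟩ := PolyLattice.IsReducedCBC.exists_weightedStarDisc_le hγ hw_zero hsum hδ
  exact ⟨C, hC, fun m s hm _ g hg => h m s hm g hg⟩
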